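/- Let $n\ge 2$, $M>0$, $\tau>0$, $0<\xi<1$, $1\le p<\infty$, $1\le r<\infty$. Let $\Omega'=\{(x',x_n)\in\mathbb{R}^{n-1}\times\mathbb{R} : x_n>\phi(x')\}$ be a special Lipschitz domain with Lipschitz constant $M$, i.e. $|\phi(x')-\phi(y')|\le M|x'-y'|$ for all $x',y'\in\mathbb{R}^{n-1}$, and put $S=\overline{\Omega'}$. Let $\mathrm{RD}\in C^\infty(S^c)$ be a regularized distance from $S$ with parameter $\xi$: for all $x\in S^c$, $(1+\xi)^{-2}\mathrm{dist}(x,S)\le \mathrm{RD}(x)\le (1-\xi)^{-2}\mathrm{dist}(x,S)$ and $|\partial^\alpha \mathrm{RD}(x)|\le P_\alpha(\xi\,\mathrm{dist}(x,S))^{1-|\alpha|}$ for every multi-index $\alpha$ with $|\alpha|\ge 1$. Let $P$ be a number with $P_\alpha\le P$ whenever $|\alpha|=1$. Let $\psi:\mathbb{R}\to\mathbb{R}$ be such that $t^m\psi(t)$ is integrable on $(1,\infty)$ for all integers $m\ge 0$, $\int_1^\infty\psi(t)\,dt=1$, and $\int_1^\infty t^m\psi(t)\,dt=0$ for all integers $m\ge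 1$. Let $A_0,A_1$ satisfy $|\psi(t)|\le A_0/t^2$ and $|\psi(t)|\le A_1/t^3$ for all $t\ge 1$. Put $g^*=(1+\tau)(1+\xi)^2\sqrt{1+M^2}\;\mathrm{RD}$ and let $E=E_{\Omega',\tau,\xi}$ be Stein's extension operator $$(Eu)(x',x_n)=\begin{cases}u(x',x_n), & (x',x_n)\in\overline{\Omega'},\\ \displaystyle\int_1^\infty u\bigl(x',x_n+t\,g^*(x',x_n)\bigr)\psi(t)\,dt, & (x',x_n)\notin\overline{\Omega'}.\end{cases}$$ Define $$Q=\frac{p(1+\tau)(1+\xi)^2}{(p+1)\tau^{1+1/p}(1-\xi)^2}\sqrt{1+M^2},\qquad B=A_1P(1+\xi)^2(1+\tau)\sqrt{1+M^2},$$ $$A=\{(A_0Q)^p+1\}^{1/p},$$ $$A'=\max\Bigl\{2^{p-1}(A_0Q)^p+1,\ \bigl[(n-1)2^{p-1}(BQ)^p+\{(A_0+B)Q\}^p+1\bigr]^{1/p}\Bigr\},$$ and $\|\nabla v\|_{L^p(G)}=\bigl(\sum_{j=1}^n\int_G|\partial_{x_j}v|^p\,dx\bigr)^{1/p}$ with weak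 derivatives. Then for every real-valued $u\in W^{1,r}(\Omega')$ one has $Eu\in W^{1,r}(\mathbb{R}^n)$, $$\|Eu\|_{L^p(\mathbb{R}^n)}\le A\,\|u\|_{L^p(\Omega')}\qquad\text{and}\qquad \|\nabla(Eu)\|_{L^p(\mathbb{R}^n)}\le A'\,\|\nabla u\|_{L^p(\Omega')},$$ where, if $r\ne p$, the norms are allowed to be infinite. In particular (taking $r=2$) this holds for every $u\in H^1(\Omega')$, and (taking $r=p$) for every $u\in W^{1,p}(\Omega')$. -/

import Mathlib

open MeasureTheory
open scoped ENNReal ContDiff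

noncomputable section

namespace SteinExtension

/-- Euclidean space of dimension `n`, with the norm `|x| = (∑ xᵢ²) ^ (1/2)` and Lebesgue measure. -/
abbrev Euc (n : ℕ) : Type := EuclideanSpace ℝ (Fin n)

/-- The classical partial derivative of `f` in the `i`-th coordinate direction. -/
def partialDeriv {n : ℕ} (i : Fin n) (f : Euc n → ℝ) : Euc n → ℝ :=
  fun x => fderiv ℝ f x (EuclideanSpace.single i 1)

/-- The classical partial derivative for the multi-index `α`: differentiate `α i` times in the
`i`-th coordinate direction, for every `i`. -/
def multiDeriv {n : ℕ} (α : Fin n → ℕ) (f : Euc n → ℝ) : Euc n → ℝ :=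
  (List.finRange n).foldr (fun i g => (partialDeriv i)^[α i] g) f

/-- `δ` is a regularized distance from the closed set `S` with parameter `ξ` and with derivative
bounds `P α`. Only the values of `δ` on the open set `Sᶜ` matter. -/
structure IsRegularizedDistance {n : ℕ} (S : Set (Euc n)) (ξ : ℝ) (P : (Fin n → ℕ) → ℝ)
    (δ : Euc n → ℝ) : Prop where
  smooth : ContDiffOn ℝ ∞ δ Sᶜ
  lower : ∀ x ∈ Sᶜ, ((1 + ξ) ^ 2)⁻¹ * Metric.infDist x S ≤ δ x
  upper : ∀ x ∈ Sᶜ, δ x ≤ ((1 - ξ) ^ 2)⁻¹ * Metric.infDist x S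
  deriv_le : ∀ α : Fin n → ℕ, 1 ≤ ∑ i, α i → ∀ x ∈ Sᶜ,
    |multiDeriv α δ x| ≤ P α * (ξ * Metric.infDist x S) ^ (1 - ((∑ i, α i : ℕ) : ℤ))

/-- The first `d` coordinates `x'` of a point `x = (x', xₙ)` of `ℝⁿ`, `n = d + 1`. -/
def horiz {d : ℕ} (x : Euc (d + 1)) : Euc d := WithLp.toLp 2 fun i => x i.castSucc

/-- `Ω` is a special Lipschitz domain with Lipschitz constant `M`: the set of points lying
strictly above the graph of an `M`-Lipschitz function of the first `d = n - 1` coordinates. -/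
def IsSpecialLipschitzDomain {d : ℕ} (M : ℝ) (Ω : Set (Euc (d + 1))) : Prop :=
  0 < M ∧ ∃ φ : Euc d → ℝ, (∀ x y, |φ x - φ y| ≤ M * ‖x - y‖) ∧
    Ω = {x | φ (horiz x) < x (Fin.last d)}

/-- The kernel `ψ` has integral `1` over `(1, ∞)`, and all its higher moments there vanish. -/
structure IsSteinKernel (ψ : ℝ → ℝ) : Prop where
  integrable : ∀ m : ℕ, IntegrableOn (fun t => t ^ m * ψ t) (Set.Ioi 1)
  integral_one : ∫ t in Set.Ioi 1, ψ t = 1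
  moment_zero : ∀ m : ℕ, 1 ≤ m → ∫ t in Set.Ioi 1, t ^ m * ψ t = 0

/-- The function `g* = (1 + τ) C RD` with `C = (1 + ξ)² √(1 + M²)`, where `δ` is the regularized
distance `RD`. -/
def gStar {d : ℕ} (M τ ξ : ℝ) (δ : Euc (d + 1) → ℝ) (x : Euc (d + 1)) : ℝ :=
  (1 + τ) * ((1 + ξ) ^ 2 * √(1 + M ^ 2)) * δ x

open Classical in
/-- Stein's extension operator for the special Lipschitz domain `Ω`. -/
def steinExt {d : ℕ} (Ω : Set (Euc (d + 1))) (M τ ξ : ℝ) (δ : Euc (d + 1) → ℝ) (ψ : ℝ → ℝ)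
    (u : Euc (d + 1) → ℝ) (x : Euc (d + 1)) : ℝ :=
  if x ∈ closure Ω then u x
  else ∫ t in Set.Ioi 1,
    u (x + EuclideanSpace.single (Fin.last d) (t * gStar M τ ξ δ x)) * ψ t

/-- `G = (G₁, …, Gₙ)` is the weak gradient of `u` on the open set `Ω`. -/
def IsWeakGrad {n : ℕ} (Ω : Set (Euc n)) (u : Euc n → ℝ) (G : Fin n → Euc n → ℝ) : Prop :=
  LocallyIntegrableOn u Ω ∧ ∀ j, LocallyIntegrableOn (G j) Ω ∧
    ∀ η : Euc n → ℝ, ContDiff ℝ ∞ η → HasCompactSupport η → tsupport η ⊆ Ω →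
      ∫ x in Ω, u x * partialDeriv j η x = -∫ x in Ω, G j x * η x

/-- `u` belongs to the Sobolev space `W^{1,r}(Ω)`. -/
def MemW1 {n : ℕ} (Ω : Set (Euc n)) (r : ℝ) (u : Euc n → ℝ) : Prop :=
  MemLp u (ENNReal.ofReal r) (volume.restrict Ω) ∧
    ∃ G, IsWeakGrad Ω u G ∧ ∀ j, MemLp (G j) (ENNReal.ofReal r) (volume.restrict Ω)

/-- The norm `‖G‖_{L^p(Ω)} = (∑ⱼ ∫_Ω |Gⱼ|^p) ^ (1/p)` of a gradient, possibly infinite. -/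
def gradLpNorm {n : ℕ} (Ω : Set (Euc n)) (p : ℝ) (G : Fin n → Euc n → ℝ) : ℝ≥0∞ :=
  (∑ j, ∫⁻ x in Ω, ‖G j x‖ₑ ^ p) ^ (1 / p)

/-- The quantity `Q`. -/
def constQ (M τ ξ p : ℝ) : ℝ :=
  p * (1 + τ) * (1 + ξ) ^ 2 / ((p + 1) * τ ^ (1 + 1 / p) * (1 - ξ) ^ 2) * √(1 + M ^ 2)

/-- The quantity `B`. -/
def constB (M τ ξ A₁ P : ℝ) : ℝ :=
  A₁ * P * (1 + ξ) ^ 2 * (1 + τ) * √(1 + M ^ 2)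

/-- The constant `A = {(A₀ Q)^p + 1}^{1/p}`. -/
def constA (M τ ξ p A₀ : ℝ) : ℝ :=
  ((A₀ * constQ M τ ξ p) ^ p + 1) ^ (1 / p)

/-- The constant `A'` for the dimension `n`. -/
def constA' (n : ℕ) (M τ ξ p A₀ A₁ P : ℝ) : ℝ :=
  max ((2 : ℝ) ^ (p - 1) * (A₀ * constQ M τ ξ p) ^ p + 1)
    ((((n : ℝ) - 1) * (2 : ℝ) ^ (p - 1) * (constB M τ ξ A₁ P * constQ M τ ξ p) ^ p
      + ((A₀ + constB M τ ξ A₁ P) * constQ M τ ξ p) ^ p + 1) ^ (1 / p))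

end SteinExtension

end

/-!
Let `φ` be the Lipschitz function whose graph bounds `Ω`, so that `Ω` is `above φ` and the
complement of its closure is `below φ`, and let `g` be the function `g*` below the graph, extended
by `0`. Let `v(x) = φ(x') - xₙ` be the depth below the graph. It is comparable to the distance to
`Ω`, which gives `(1 + τ) v ≤ g ≤ K v` there (`isScale_gExt`); hence `x + t g(x) eₙ` lies in `Ω`
for all `t ≥ 1`.

*Bounds in `L^p`.* Below the graph `|Eu|` is at most `A₀` times the average `vertAvg` of `|u|`
against the weight `t ^ (-2)`. After the substitution `s = t g - v` on a vertical line this is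
dominated by `K / τ` times a Hardy average of `|u|`, and Hardy's inequality with its sharp constant
(`hardy_inequality`) gives the factor `Q`. This is `IsScale.lintegral_vertAvg_le`; it holds for
every `p`, whether or not the norms are finite.

*Weak derivatives.* The regularized distance has bounded first derivatives and is at most a
multiple of the distance, so `g` is Lipschitz on the whole space (`lipschitzWith_of_infDist`). Since
`ψ` has integral `1` and `g` vanishes off `below φ`, the extension of a smooth Lipschitz function
`v` is `∫ v(x + t g(x) eₙ) ψ(t) dt` everywhere, and it is Lipschitz. Integration by parts for
Lipschitz functions, which contains Rademacher's theorem, then identifies its weak gradient, with no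
boundary term, as `∂ⱼv` above the graph and as
`∫ ∂ⱼv(x + t g eₙ) ψ(t) dt + ∂ⱼg ∫ ∂ₙv(x + t g eₙ) t ψ(t) dt` below it
(`integral_extension_mul_partialDeriv`). A function in `W^{1,r}(Ω)` is mollified with kernels
supported below the origin; in `Ω` these mollifications commute with weak differentiation, they
converge in `L^r(Ω)` together with their gradients, and the bounds above carry the formula to the
limit (`IsScale.integral_patch_mul_partialDeriv`).

*Bounds for the gradient.* Weak gradients are unique (`IsWeakGrad.ae_eq`), so it is enough to
estimate the formula just obtained. The first integral is controlled by `A₀ Q`. The second one is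
controlled by `B Q`, because `|t ψ(t)| ≤ A₁ / t ^ 2` and `|∂ⱼg|` is at most
`(1 + τ) (1 + ξ) ^ 2 √(1 + M ^ 2) P`. Summation over `j` gives `A'` (`sum_gradient_bound`).
-/

noncomputable section

namespace SteinExtension

open Set Filter Topology NNReal

/-! ### Splitting off the last coordinate -/

/-- The point `(y, s)` of `ℝ^d × ℝ = ℝ^(d+1)`. -/
def glue {d : ℕ} (y : Euc d) (s : ℝ) : Euc (d + 1) :=
  WithLp.toLp 2 (Fin.snoc (α := fun _ => ℝ) (fun i => y i) s)

@[simp] lemma glue_last {d : ℕ} (y : Euc d) (s : ℝ) : glue y s (Fin.last d) = s := by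
  simp [glue]

@[simp] lemma horiz_glue {d : ℕ} (y : Euc d) (s : ℝ) : horiz (glue y s) = y := by
  ext i; simp [glue, horiz]

lemma glue_horiz {d : ℕ} (x : Euc (d + 1)) : glue (horiz x) (x (Fin.last d)) = x := by
  ext i
  refine Fin.lastCases ?_ (fun i => ?_) i <;> simp [glue, horiz]

@[simp] lemma single_last_castSucc {d : ℕ} (c : ℝ) (i : Fin d) :
    (EuclideanSpace.single (Fin.last d) c : Euc (d + 1)) i.castSucc = 0 := by
  simp [(Fin.castSucc_lt_last i).ne]

@[simp] lemma horiz_add_single {d : ℕ} (x : Euc (d + 1)) (c : ℝ) :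
    horiz (x + EuclideanSpace.single (Fin.last d) c) = horiz x := by
  ext i; simp [horiz]

lemma glue_add_single {d : ℕ} (y : Euc d) (s c : ℝ) :
    glue y s + EuclideanSpace.single (Fin.last d) c = glue y (s + c) := by
  rw [← glue_horiz (glue y s + _)]; simp

lemma measurePreserving_glue (d : ℕ) :
    MeasurePreserving (fun q : Euc d × ℝ => glue q.1 q.2) := by
  have h1 : MeasurePreserving (fun q : Euc d × ℝ => (q.2, WithLp.ofLp q.1)) :=
    Measure.measurePreserving_swap.comp
      ((PiLp.volume_preserving_ofLp (Fin d)).prod (MeasurePreserving.id _))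
  have h2 := (volume_preserving_piFinSuccAbove (fun _ : Fin (d + 1) => ℝ) (Fin.last d)).symm
  have h3 := (PiLp.volume_preserving_toLp (Fin (d + 1))).comp (h2.comp h1)
  convert h3 using 1
  funext q
  ext i
  refine Fin.lastCases ?_ (fun i => ?_) i <;>
    simp [glue, MeasurableEquiv.piFinSuccAbove, Fin.insertNthEquiv]

lemma measurable_glue {d : ℕ} (y : Euc d) : Measurable (glue y) :=
  (measurePreserving_glue d).measurable.comp measurable_prodMk_left

lemma continuous_horiz {d : ℕ} : Continuous (horiz : Euc (d + 1) → Euc d) := by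
  unfold horiz; fun_prop

lemma continuous_last {d : ℕ} : Continuous (fun x : Euc (d + 1) => x (Fin.last d)) := by
  fun_prop

/-- Tonelli's theorem, the last coordinate being integrated first. -/
lemma lintegral_eq_lintegral_glue {d : ℕ} {F : Euc (d + 1) → ℝ≥0∞} (hF : Measurable F) :
    ∫⁻ x, F x = ∫⁻ y, ∫⁻ s, F (glue y s) := by
  rw [← (measurePreserving_glue d).lintegral_comp hF, Measure.volume_eq_prod,
    lintegral_prod (fun q : Euc d × ℝ => F (glue q.1 q.2))
      (hF.comp (measurePreserving_glue d).measurable).aemeasurable]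

/-! ### Hardy's inequality -/

/-- Affine change of variables on the line. -/
lemma lintegral_comp_affine {f : ℝ → ℝ≥0∞} (hf : Measurable f) {a : ℝ} (ha : 0 < a) (b : ℝ) :
    ∫⁻ t, f (a * t + b) = ENNReal.ofReal a⁻¹ * ∫⁻ s, f s := by
  have h := lintegral_map (μ := volume) (f := fun s => f (s + b)) (g := fun t : ℝ => a * t)
    (by fun_prop) (by fun_prop)
  rw [← h, Real.map_volume_mul_left ha.ne', lintegral_smul_measure,
    lintegral_add_right_eq_self f b, abs_of_pos (inv_pos.2 ha), smul_eq_mul]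

lemma setLIntegral_Ioi_comp_mul {f : ℝ → ℝ≥0∞} (hf : Measurable f) {a : ℝ} (ha : 0 < a) :
    ∫⁻ t in Ioi 0, f (a * t) = ENNReal.ofReal a⁻¹ * ∫⁻ s in Ioi 0, f s := by
  have := lintegral_comp_affine (hf.indicator (measurableSet_Ioi (a := (0 : ℝ)))) ha 0
  rw [← lintegral_indicator measurableSet_Ioi, ← lintegral_indicator measurableSet_Ioi, ← this]
  congr with t
  simp [indicator, mul_pos_iff_of_pos_left ha]

/-- Jensen's inequality for powers and a finite measure. -/
lemma lintegral_rpow_le_measure_univ_mul {α : Type*} [MeasurableSpace α] (μ : Measure α)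
    {h : α → ℝ≥0∞} (hh : Measurable h) {p : ℝ} (hp : 1 ≤ p) :
    (∫⁻ a, h a ∂μ) ^ p ≤ μ univ ^ (p - 1) * ∫⁻ a, h a ^ p ∂μ := by
  have hp0 : 0 < p := by linarith
  have H := eLpNorm'_le_eLpNorm'_mul_rpow_measure_univ (μ := μ) (f := h) zero_lt_one hp
    hh.aestronglyMeasurable
  simp only [eLpNorm', enorm_eq_self, ENNReal.rpow_one, div_one] at H
  calc (∫⁻ a, h a ∂μ) ^ p
      ≤ ((∫⁻ a, h a ^ p ∂μ) ^ (1 / p) * μ univ ^ (1 - 1 / p)) ^ p := by gcongr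
    _ = _ := by
      rw [ENNReal.mul_rpow_of_nonneg _ _ hp0.le, ← ENNReal.rpow_mul, ← ENNReal.rpow_mul, mul_comm]
      congr 2
      · field_simp
      · rw [one_div_mul_cancel hp0.ne', ENNReal.rpow_one]

lemma lintegral_Ioi_rpow {a : ℝ} (ha : a < -1) :
    ∫⁻ t in Ioi (1 : ℝ), ENNReal.ofReal (t ^ a) = ENNReal.ofReal (-1 / (a + 1)) := by
  rw [← ofReal_integral_eq_lintegral_ofReal (integrableOn_Ioi_rpow_of_lt ha one_pos),
    integral_Ioi_rpow_of_lt ha one_pos, Real.one_rpow]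
  filter_upwards [ae_restrict_mem measurableSet_Ioi] with t ht
  exact Real.rpow_nonneg (zero_le_one.trans (le_of_lt ht)) _

/-- Hardy's inequality with its sharp constant: apply Jensen's inequality to the weight
`σ ^ (-2 - 1/p)`, exchange the integrals and rescale. -/
lemma hardy_inequality {f : ℝ → ℝ≥0∞} (hf : Measurable f) {p c : ℝ} (hp : 1 ≤ p) (hc : 0 < c) :
    ∫⁻ v in Ioi 0, (∫⁻ σ in Ioi 1, f (c * v * σ) * ENNReal.ofReal (σ ^ 2)⁻¹) ^ p ≤
      ENNReal.ofReal ((p / (p + 1)) ^ p / c) * ∫⁻ s in Ioi 0, f s ^ p := by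
  have hp0 : 0 < p := by linarith
  have hpa : -2 - 1 / p < -1 := by have := one_div_pos.2 hp0; linarith
  set w : ℝ → ℝ≥0∞ := fun σ => ENNReal.ofReal (σ ^ (-2 - 1 / p)) with hw
  have hwm : Measurable w := by fun_prop
  set μ := (volume.restrict (Ioi (1 : ℝ))).withDensity w with hμ
  have hμu : μ univ = ENNReal.ofReal (p / (p + 1)) := by
    rw [hμ, withDensity_apply _ MeasurableSet.univ, Measure.restrict_univ, hw,
      lintegral_Ioi_rpow hpa]
    have : -2 - 1 / p + 1 = -((p + 1) / p) := by field_simp; ring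
    rw [this, neg_div_neg_eq, one_div_div]
  have h1 : ∀ v, (∫⁻ σ in Ioi 1, f (c * v * σ) * ENNReal.ofReal (σ ^ 2)⁻¹) ^ p ≤
      μ univ ^ (p - 1) *
        ∫⁻ σ in Ioi 1, f (c * v * σ) ^ p * ENNReal.ofReal (σ ^ (-1 - 1 / p)) := by
    intro v
    have e1 : ∫⁻ σ in Ioi 1, f (c * v * σ) * ENNReal.ofReal (σ ^ 2)⁻¹ =
        ∫⁻ σ, f (c * v * σ) * ENNReal.ofReal (σ ^ (1 / p)) ∂μ := by
      rw [hμ, lintegral_withDensity_eq_lintegral_mul _ hwm (by fun_prop)]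
      refine setLIntegral_congr_fun measurableSet_Ioi fun σ hσ => ?_
      have hσ0 : (0 : ℝ) < σ := one_pos.trans hσ
      simp only [Pi.mul_apply, hw]
      rw [mul_left_comm, ← ENNReal.ofReal_mul (by positivity), ← Real.rpow_add hσ0,
        sub_add_cancel, ← Real.rpow_natCast, ← Real.rpow_neg hσ0.le]
      norm_num
    have e2 : ∫⁻ σ in Ioi 1, f (c * v * σ) ^ p * ENNReal.ofReal (σ ^ (-1 - 1 / p)) =
        ∫⁻ σ, (f (c * v * σ) * ENNReal.ofReal (σ ^ (1 / p))) ^ p ∂μ := by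
      rw [hμ, lintegral_withDensity_eq_lintegral_mul _ hwm (by fun_prop)]
      refine setLIntegral_congr_fun measurableSet_Ioi fun σ hσ => ?_
      have hσ0 : (0 : ℝ) < σ := one_pos.trans hσ
      simp only [Pi.mul_apply, hw]
      rw [ENNReal.mul_rpow_of_nonneg _ _ hp0.le,
        ENNReal.ofReal_rpow_of_pos (by positivity), ← Real.rpow_mul hσ0.le,
        one_div_mul_cancel hp0.ne', mul_left_comm, ← ENNReal.ofReal_mul (by positivity),
        ← Real.rpow_add hσ0]
      congr 3
      ring
    rw [e1, e2]
    exact lintegral_rpow_le_measure_univ_mul μ (by fun_prop) hp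
  have hscale : ∀ σ ∈ Ioi (1 : ℝ), ∫⁻ v in Ioi 0,
      f (c * v * σ) ^ p * ENNReal.ofReal (σ ^ (-1 - 1 / p)) =
      ENNReal.ofReal c⁻¹ * (∫⁻ s in Ioi 0, f s ^ p) * w σ := by
    intro σ hσ
    have hσ0 : (0 : ℝ) < σ := one_pos.trans hσ
    rw [lintegral_mul_const _ (by fun_prop)]
    have := setLIntegral_Ioi_comp_mul (hf.pow_const p) (mul_pos hc hσ0)
    simp only [mul_right_comm c σ] at this
    rw [this, mul_right_comm, mul_right_comm (ENNReal.ofReal c⁻¹), ← ENNReal.ofReal_mul (by positivity),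
      ← ENNReal.ofReal_mul (by positivity)]
    congr 2
    rw [mul_inv, mul_assoc, ← Real.rpow_neg_one σ, ← Real.rpow_add hσ0]
    congr 2
    ring
  calc _ ≤ ∫⁻ v in Ioi 0, μ univ ^ (p - 1) *
        ∫⁻ σ in Ioi 1, f (c * v * σ) ^ p * ENNReal.ofReal (σ ^ (-1 - 1 / p)) :=
        lintegral_mono fun v => h1 v
    _ = μ univ ^ (p - 1) * ∫⁻ v in Ioi 0, ∫⁻ σ in Ioi 1,
          f (c * v * σ) ^ p * ENNReal.ofReal (σ ^ (-1 - 1 / p)) := by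
        rw [lintegral_const_mul]
        exact Measurable.lintegral_prod_right' (f := fun q : ℝ × ℝ =>
          f (c * q.1 * q.2) ^ p * ENNReal.ofReal (q.2 ^ (-1 - 1 / p))) (by fun_prop)
    _ = μ univ ^ (p - 1) * ∫⁻ σ in Ioi 1, ENNReal.ofReal c⁻¹ * (∫⁻ s in Ioi 0, f s ^ p) * w σ := by
        rw [lintegral_lintegral_swap (by fun_prop)]
        congr 1
        exact setLIntegral_congr_fun measurableSet_Ioi hscale
    _ = _ := by
        have hpp : 0 < p / (p + 1) := by positivity
        rw [lintegral_const_mul _ hwm]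
        have : ∫⁻ σ in Ioi 1, w σ = μ univ := by
          rw [hμ, withDensity_apply _ MeasurableSet.univ, Measure.restrict_univ]
        rw [this, hμu, mul_comm (_ * _) (ENNReal.ofReal (p / (p + 1))), ← mul_assoc, ← mul_assoc,
          ENNReal.ofReal_rpow_of_pos hpp, ← ENNReal.ofReal_mul (by positivity),
          ← ENNReal.ofReal_mul (by positivity)]
        congr 2
        rw [← Real.rpow_add_one hpp.ne', sub_add_cancel, div_eq_mul_inv _ c]

/-! ### Vertical averages -/

/-- The average of `F` over the vertical half-line above `x`, at the scale `g x`, against the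
weight `t ^ (-2)`. -/
def vertAvg {d : ℕ} (g : Euc (d + 1) → ℝ) (F : Euc (d + 1) → ℝ≥0∞) (x : Euc (d + 1)) : ℝ≥0∞ :=
  ∫⁻ t in Ioi 1, F (x + EuclideanSpace.single (Fin.last d) (t * g x)) * ENNReal.ofReal (t ^ 2)⁻¹

lemma single_last_eq_smul {d : ℕ} (c : ℝ) :
    (EuclideanSpace.single (Fin.last d) c : Euc (d + 1)) =
      c • EuclideanSpace.single (Fin.last d) 1 := by
  ext i; simp

lemma continuous_single_last {d : ℕ} :
    Continuous (fun c : ℝ => (EuclideanSpace.single (Fin.last d) c : Euc (d + 1))) := by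
  rw [funext fun c => single_last_eq_smul (d := d) c]
  fun_prop

@[fun_prop] lemma measurable_single {d : ℕ} :
    Measurable (fun c : ℝ => (EuclideanSpace.single (Fin.last d) c : Euc (d + 1))) :=
  continuous_single_last.measurable

lemma measurable_vertAvg {d : ℕ} {g : Euc (d + 1) → ℝ} (hg : Measurable g)
    {F : Euc (d + 1) → ℝ≥0∞} (hF : Measurable F) : Measurable (vertAvg g F) := by
  unfold vertAvg
  exact Measurable.lintegral_prod_right' (f := fun q : Euc (d + 1) × ℝ =>
      F (q.1 + EuclideanSpace.single (Fin.last d) (q.2 * g q.1)) * ENNReal.ofReal (q.2 ^ 2)⁻¹)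
      (by fun_prop)

/-- On each vertical line, the average is dominated by the Hardy average at the scale of the
depth below the graph. -/
lemma lintegral_vertical_le {f : ℝ → ℝ≥0∞} (hf : Measurable f) {τ K v a : ℝ} (hτ : 0 < τ)
    (hv : 0 < v) (h1 : (1 + τ) * v ≤ a) (h2 : a ≤ K * v) :
    ∫⁻ t in Ioi 1, f (t * a - v) * ENNReal.ofReal (t ^ 2)⁻¹ ≤
      ENNReal.ofReal (K / τ) * ∫⁻ σ in Ioi 1, f (τ * v * σ) * ENNReal.ofReal (σ ^ 2)⁻¹ := by
  have ha : 0 < a := lt_of_lt_of_le (by positivity) h1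
  have hτv : 0 < τ * v := by positivity
  set Ψ : ℝ → ℝ≥0∞ := (Ioi (1 : ℝ)).indicator
    fun σ => f (τ * v * σ) * ENNReal.ofReal ((a / (τ * v)) ^ 2 * (σ ^ 2)⁻¹) with hΨ
  have hΨm : Measurable Ψ := Measurable.indicator (by fun_prop) measurableSet_Ioi
  -- the substitution `σ = (a t - v) / (τ v)`; since `a ≥ (1 + τ) v`, it maps `t > 1` into `σ > 1`
  have key := lintegral_comp_affine hΨm (div_pos ha hτv) (-(v / (τ * v)))
  calc ∫⁻ t in Ioi 1, f (t * a - v) * ENNReal.ofReal (t ^ 2)⁻¹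
      ≤ ∫⁻ t, Ψ (a / (τ * v) * t + -(v / (τ * v))) := by
        rw [← lintegral_indicator measurableSet_Ioi]
        refine lintegral_mono fun t => indicator_apply_le' (fun ht => ?_) fun _ => zero_le
        have ht1 : (1 : ℝ) < t := ht
        have hs : τ * v * (a / (τ * v) * t + -(v / (τ * v))) = t * a - v := by
          field_simp; ring
        have hpos : τ * v < t * a - v := by nlinarith
        have hgt : 1 < a / (τ * v) * t + -(v / (τ * v)) := by
          rw [← hs] at hpos
          exact lt_of_mul_lt_mul_left (by simpa using hpos) hτv.le
        rw [hΨ, indicator_of_mem (mem_Ioi.2 hgt), hs]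
        gcongr
        set σ := a / (τ * v) * t + -(v / (τ * v))
        have hσ0 : 0 < σ := one_pos.trans hgt
        have : σ ≤ a / (τ * v) * t := by
          have : 0 < v / (τ * v) := by positivity
          simp only [σ]; linarith
        rw [← div_eq_mul_inv, ← div_pow, ← inv_pow]
        gcongr
        rw [le_div_iff₀ hσ0, inv_mul_le_iff₀ (by linarith), mul_comm]
        exact this
    _ = ENNReal.ofReal (a / (τ * v))⁻¹ * (ENNReal.ofReal ((a / (τ * v)) ^ 2) *
          ∫⁻ σ in Ioi 1, f (τ * v * σ) * ENNReal.ofReal (σ ^ 2)⁻¹) := by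
        rw [key, hΨ, lintegral_indicator measurableSet_Ioi,
          ← lintegral_const_mul (ENNReal.ofReal ((a / (τ * v)) ^ 2)) (by fun_prop)]
        congr 1
        refine lintegral_congr fun σ => ?_
        rw [ENNReal.ofReal_mul (by positivity), mul_left_comm]
    _ ≤ _ := by
        rw [← mul_assoc, ← ENNReal.ofReal_mul (by positivity)]
        gcongr
        have : (a / (τ * v))⁻¹ * (a / (τ * v)) ^ 2 = a / v / τ := by field_simp
        rw [this]
        gcongr
        rwa [div_le_iff₀ hv]

/-- The region strictly above the graph of `φ`. -/
def above {d : ℕ} (φ : Euc d → ℝ) : Set (Euc (d + 1)) := {x | φ (horiz x) < x (Fin.last d)}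

/-- The region strictly below the graph of `φ`. -/
def below {d : ℕ} (φ : Euc d → ℝ) : Set (Euc (d + 1)) := {x | x (Fin.last d) < φ (horiz x)}

/-- Below the graph of `φ`, the scale `g` is comparable to the depth, and exceeds it by the
factor `1 + τ`, so that the half-line of `vertAvg` lies above the graph. -/
structure IsScale {d : ℕ} (φ : Euc d → ℝ) (τ K : ℝ) (g : Euc (d + 1) → ℝ) : Prop where
  lower : ∀ x ∈ below φ, (1 + τ) * (φ (horiz x) - x (Fin.last d)) ≤ g x
  upper : ∀ x ∈ below φ, g x ≤ K * (φ (horiz x) - x (Fin.last d))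

section
variable {d : ℕ} {φ : Euc d → ℝ} {τ K : ℝ} {g : Euc (d + 1) → ℝ}

lemma isOpen_above (hφ : Continuous φ) : IsOpen (above φ) :=
  isOpen_lt (hφ.comp continuous_horiz) continuous_last

lemma isOpen_below (hφ : Continuous φ) : IsOpen (below φ) :=
  isOpen_lt continuous_last (hφ.comp continuous_horiz)

lemma IsScale.add_single_mem (h : IsScale φ τ K g) (hτ : 0 < τ) {x : Euc (d + 1)}
    (hx : x ∈ below φ) {t : ℝ} (ht : 1 ≤ t) :
    x + EuclideanSpace.single (Fin.last d) (t * g x) ∈ above φ := by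
  have h1 := h.lower x hx
  have h2 : x (Fin.last d) < φ (horiz x) := hx
  have h3 : φ (horiz x) - x (Fin.last d) < g x := by nlinarith
  have : φ (horiz x) < x (Fin.last d) + t * g x := by nlinarith
  simpa [above] using this

/-- The `L^p` bound for vertical averages, by Hardy's inequality on every vertical line. -/
lemma IsScale.lintegral_vertAvg_le (h : IsScale φ τ K g) (hφ : Continuous φ) (hτ : 0 < τ)
    (hK : 0 < K) (hg : Measurable g) {p : ℝ} (hp : 1 ≤ p) {F : Euc (d + 1) → ℝ≥0∞}
    (hF : Measurable F) :
    ∫⁻ x in below φ, vertAvg g F x ^ p ≤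
      ENNReal.ofReal (K * p / ((p + 1) * τ ^ (1 + 1 / p))) ^ p * ∫⁻ x in above φ, F x ^ p := by
  have hp0 : 0 < p := by linarith
  have hmb := (isOpen_below hφ).measurableSet
  have hma := (isOpen_above hφ).measurableSet
  rw [← lintegral_indicator hmb, ← lintegral_indicator hma, lintegral_eq_lintegral_glue
    (((measurable_vertAvg hg hF).pow_const p).indicator hmb), lintegral_eq_lintegral_glue
    ((hF.pow_const p).indicator hma), ← lintegral_const_mul']
  swap
  · exact ENNReal.rpow_ne_top_of_nonneg hp0.le ENNReal.ofReal_ne_top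
  refine lintegral_mono fun y => ?_
  set f : ℝ → ℝ≥0∞ := fun s => F (glue y (φ y + s)) with hf
  have hfm : Measurable f := hF.comp ((measurable_glue y).comp (by fun_prop))
  have hgl := measurable_glue y
  have e1 : ∫⁻ s, (below φ).indicator (fun x => vertAvg g F x ^ p) (glue y s) =
      ∫⁻ v in Ioi 0, vertAvg g F (glue y (φ y - v)) ^ p := by
    rw [← lintegral_indicator measurableSet_Ioi, ← lintegral_sub_left_eq_self _ (φ y)]
    congr with v
    simp [indicator, below]
  have e2 : ∫⁻ s, (above φ).indicator (fun x => F x ^ p) (glue y s) =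
      ∫⁻ s in Ioi 0, f s ^ p := by
    rw [← lintegral_indicator measurableSet_Ioi, ← lintegral_add_left_eq_self _ (φ y)]
    congr with v
    simp [indicator, above, hf]
  rw [e1, e2]
  have hle : ∀ v ∈ Ioi (0 : ℝ), vertAvg g F (glue y (φ y - v)) ^ p ≤
      ENNReal.ofReal (K / τ) ^ p *
        (∫⁻ σ in Ioi 1, f (τ * v * σ) * ENNReal.ofReal (σ ^ 2)⁻¹) ^ p := by
    intro v hv
    rw [← ENNReal.mul_rpow_of_nonneg _ _ hp0.le]
    have hx : glue y (φ y - v) ∈ below φ := by simpa [below] using hv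
    have l := h.lower _ hx
    have u := h.upper _ hx
    simp only [horiz_glue, glue_last, sub_sub_cancel] at l u
    gcongr
    refine le_trans (le_of_eq ?_) (lintegral_vertical_le hfm hτ hv l u)
    simp only [vertAvg, glue_add_single, hf]
    congr with t
    congr 3
    ring
  calc _ ≤ ∫⁻ v in Ioi 0, ENNReal.ofReal (K / τ) ^ p *
        (∫⁻ σ in Ioi 1, f (τ * v * σ) * ENNReal.ofReal (σ ^ 2)⁻¹) ^ p :=
        setLIntegral_mono' measurableSet_Ioi hle
    _ ≤ ENNReal.ofReal (K / τ) ^ p *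
        (ENNReal.ofReal ((p / (p + 1)) ^ p / τ) * ∫⁻ s in Ioi 0, f s ^ p) := by
        rw [lintegral_const_mul']
        · gcongr
          exact hardy_inequality hfm hp hτ
        · exact ENNReal.rpow_ne_top_of_nonneg hp0.le ENNReal.ofReal_ne_top
    _ = _ := by
        rw [← mul_assoc, ENNReal.ofReal_rpow_of_pos (by positivity),
          ENNReal.ofReal_rpow_of_pos (by positivity), ← ENNReal.ofReal_mul (by positivity)]
        congr 2
        have : τ = (τ ^ (1 / p)) ^ p := by
          rw [← Real.rpow_mul hτ.le, one_div_mul_cancel hp0.ne', Real.rpow_one]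
        nth_rw 2 [this]
        rw [← Real.div_rpow (by positivity) (by positivity),
          ← Real.mul_rpow (by positivity) (by positivity), Real.rpow_add hτ, Real.rpow_one]
        congr 1
        field_simp

end

/-! ### The kernel operators in `L^p` -/

lemma eLpNorm_ofReal_rpow {α : Type*} [MeasurableSpace α] (μ : Measure α) (f : α → ℝ) {p : ℝ}
    (hp : 1 ≤ p) : eLpNorm f (ENNReal.ofReal p) μ ^ p = ∫⁻ a, ‖f a‖ₑ ^ p ∂μ := by
  have hp0 : 0 < p := by linarith
  rw [eLpNorm_eq_lintegral_rpow_enorm_toReal (by simpa using hp0) ENNReal.ofReal_ne_top,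
    ENNReal.toReal_ofReal hp0.le, ← ENNReal.rpow_mul, one_div_mul_cancel hp0.ne', ENNReal.rpow_one]

/-- The integral `∫₁^∞ f(x + t g(x) eₙ) κ(t) dt`. -/
def vertInt {d : ℕ} (g : Euc (d + 1) → ℝ) (κ : ℝ → ℝ) (f : Euc (d + 1) → ℝ) (x : Euc (d + 1)) : ℝ :=
  ∫ t in Ioi 1, f (x + EuclideanSpace.single (Fin.last d) (t * g x)) * κ t

section
variable {d : ℕ} {φ : Euc d → ℝ} {τ K : ℝ} {g : Euc (d + 1) → ℝ}

/-- Null sets above the graph are not seen by vertical averages: the `L¹` bound applied to the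
indicator of a null set. -/
lemma IsScale.ae_ae_eq (h : IsScale φ τ K g) (hφ : Continuous φ) (hτ : 0 < τ)
    (hK : 0 < K) (hg : Measurable g) {β : Type*} {F₁ F₂ : Euc (d + 1) → β}
    (hF : F₁ =ᵐ[volume.restrict (above φ)] F₂) :
    ∀ᵐ x ∂volume.restrict (below φ), ∀ᵐ t ∂volume.restrict (Ioi (1 : ℝ)),
      F₁ (x + EuclideanSpace.single (Fin.last d) (t * g x)) =
        F₂ (x + EuclideanSpace.single (Fin.last d) (t * g x)) := by
  set μ := volume.restrict (above φ)
  set N := toMeasurable μ {x | F₁ x ≠ F₂ x}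
  have hN : MeasurableSet N := measurableSet_toMeasurable _ _
  have hN0 : μ N = 0 := by rw [measure_toMeasurable]; exact hF
  have hm : Measurable (N.indicator fun _ => (1 : ℝ≥0∞)) := measurable_const.indicator hN
  have key := h.lintegral_vertAvg_le hφ hτ hK hg le_rfl hm
  simp only [ENNReal.rpow_one] at key
  rw [lintegral_indicator_const hN, hN0, mul_zero, mul_zero, nonpos_iff_eq_zero,
    lintegral_eq_zero_iff (measurable_vertAvg hg hm)] at key
  filter_upwards [key] with x hx
  rw [Pi.zero_apply, vertAvg, lintegral_eq_zero_iff (by fun_prop)] at hx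
  filter_upwards [hx, ae_restrict_mem measurableSet_Ioi] with t ht ht1
  have ht0 : (0 : ℝ) < t := one_pos.trans ht1
  by_contra hne
  have hmem : x + EuclideanSpace.single (Fin.last d) (t * g x) ∈ N :=
    subset_toMeasurable μ _ hne
  rw [indicator_of_mem hmem] at ht
  simp [ht0.ne'] at ht

lemma IsScale.lintegral_vertAvg_le' (h : IsScale φ τ K g) (hφ : Continuous φ) (hτ : 0 < τ)
    (hK : 0 < K) (hg : Measurable g) {p : ℝ} (hp : 1 ≤ p) {F : Euc (d + 1) → ℝ≥0∞}
    (hF : AEMeasurable F (volume.restrict (above φ))) :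
    ∫⁻ x in below φ, vertAvg g F x ^ p ≤
      ENNReal.ofReal (K * p / ((p + 1) * τ ^ (1 + 1 / p))) ^ p * ∫⁻ x in above φ, F x ^ p := by
  have h1 := h.lintegral_vertAvg_le hφ hτ hK hg hp hF.measurable_mk
  have h2 : ∫⁻ x in above φ, hF.mk F x ^ p = ∫⁻ x in above φ, F x ^ p :=
    lintegral_congr_ae (by filter_upwards [hF.ae_eq_mk] with x hx; rw [hx])
  rw [h2] at h1
  refine le_trans (le_of_eq (lintegral_congr_ae ?_)) h1
  filter_upwards [h.ae_ae_eq hφ hτ hK hg hF.ae_eq_mk] with x hx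
  congr 1
  refine lintegral_congr_ae ?_
  filter_upwards [hx] with t ht
  rw [ht]

variable {κ : ℝ → ℝ} {C : ℝ}

lemma enorm_mul_kernel_le (hκ : ∀ t, 1 ≤ t → |κ t| ≤ C / t ^ 2) {t : ℝ} (ht : 1 ≤ t) (a : ℝ) :
    ‖a * κ t‖ₑ ≤ ENNReal.ofReal C * (‖a‖ₑ * ENNReal.ofReal (t ^ 2)⁻¹) := by
  have hC : 0 ≤ C := by
    have := (abs_nonneg _).trans (hκ 1 le_rfl); simpa using this
  rw [enorm_mul, mul_left_comm, ← ENNReal.ofReal_mul hC, Real.enorm_eq_ofReal_abs (κ t)]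
  gcongr
  exact (hκ t ht).trans_eq (div_eq_mul_inv _ _)

lemma lintegral_enorm_mul_kernel_le (hκ : ∀ t, 1 ≤ t → |κ t| ≤ C / t ^ 2)
    (f : Euc (d + 1) → ℝ) (x : Euc (d + 1)) :
    ∫⁻ t in Ioi 1, ‖f (x + EuclideanSpace.single (Fin.last d) (t * g x)) * κ t‖ₑ ≤
      ENNReal.ofReal C * vertAvg g (fun y => ‖f y‖ₑ) x := by
  rw [vertAvg, ← lintegral_const_mul' _ _ ENNReal.ofReal_ne_top]
  exact setLIntegral_mono' measurableSet_Ioi fun t ht => enorm_mul_kernel_le hκ (le_of_lt ht) _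

lemma enorm_vertInt_le (hκ : ∀ t, 1 ≤ t → |κ t| ≤ C / t ^ 2) (f : Euc (d + 1) → ℝ)
    (x : Euc (d + 1)) :
    ‖vertInt g κ f x‖ₑ ≤ ENNReal.ofReal C * vertAvg g (fun y => ‖f y‖ₑ) x :=
  (enorm_integral_le_lintegral_enorm _).trans (lintegral_enorm_mul_kernel_le hκ f x)

lemma IsScale.ae_integrable (h : IsScale φ τ K g) (hφ : Continuous φ) (hτ : 0 < τ)
    (hK : 0 < K) (hg : Measurable g) (hκ : ∀ t, 1 ≤ t → |κ t| ≤ C / t ^ 2)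
    (hκm : AEStronglyMeasurable κ (volume.restrict (Ioi 1))) {r : ℝ} (hr : 1 ≤ r)
    {f : Euc (d + 1) → ℝ} (hf : MemLp f (ENNReal.ofReal r) (volume.restrict (above φ))) :
    ∀ᵐ x ∂volume.restrict (below φ), IntegrableOn
      (fun t => f (x + EuclideanSpace.single (Fin.last d) (t * g x)) * κ t) (Ioi 1) := by
  have hr0 : 0 < r := by linarith
  have hfm := hf.aestronglyMeasurable
  have hfin : ∫⁻ x in below φ, vertAvg g (fun y => ‖f y‖ₑ) x ^ r ≠ ⊤ := by
    refine ne_top_of_le_ne_top ?_ (h.lintegral_vertAvg_le' hφ hτ hK hg hr hfm.enorm)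
    rw [← eLpNorm_ofReal_rpow _ _ hr]
    exact ENNReal.mul_ne_top (ENNReal.rpow_ne_top_of_nonneg hr0.le ENNReal.ofReal_ne_top)
      (ENNReal.rpow_ne_top_of_nonneg hr0.le hf.eLpNorm_ne_top)
  have hfg := h.ae_ae_eq hφ hτ hK hg hfm.ae_eq_mk
  -- a measurable representative makes the average measurable
  have hmeas : AEMeasurable (fun x => vertAvg g (fun y => ‖f y‖ₑ) x ^ r)
      (volume.restrict (below φ)) := by
    refine ⟨fun x => vertAvg g (fun y => ‖hfm.mk f y‖ₑ) x ^ r,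
      (measurable_vertAvg hg hfm.stronglyMeasurable_mk.enorm).pow_const r, ?_⟩
    filter_upwards [hfg] with x hx
    congr 1
    refine lintegral_congr_ae ?_
    filter_upwards [hx] with t ht
    rw [ht]
  filter_upwards [ae_lt_top' hmeas hfin, hfg] with x hx hx2
  have hx' : vertAvg g (fun y => ‖f y‖ₑ) x < ⊤ := by
    rwa [ENNReal.rpow_lt_top_iff_of_pos hr0] at hx
  refine ⟨AEStronglyMeasurable.mul ?_ hκm, ?_⟩
  · refine AEStronglyMeasurable.congr (f := fun t => hfm.mk f (x + EuclideanSpace.single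
      (Fin.last d) (t * g x))) ?_ (by filter_upwards [hx2] with t ht; rw [ht])
    exact (hfm.stronglyMeasurable_mk.comp_measurable (by fun_prop)).aestronglyMeasurable
  · exact (lintegral_enorm_mul_kernel_le hκ f x).trans_lt
      (ENNReal.mul_lt_top ENNReal.ofReal_lt_top hx')

lemma IsScale.aestronglyMeasurable_vertInt (h : IsScale φ τ K g) (hφ : Continuous φ) (hτ : 0 < τ)
    (hK : 0 < K) (hg : Measurable g)
    (hκm : AEStronglyMeasurable κ (volume.restrict (Ioi 1)))
    {f : Euc (d + 1) → ℝ} (hfm : AEStronglyMeasurable f (volume.restrict (above φ))) :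
    AEStronglyMeasurable (vertInt g κ f) (volume.restrict (below φ)) := by
  have hfg := h.ae_ae_eq hφ hτ hK hg hfm.ae_eq_mk
  refine ⟨vertInt g (hκm.mk κ) (hfm.mk f), ?_, ?_⟩
  · refine StronglyMeasurable.integral_prod_right (f := fun x t => hfm.mk f (x +
      EuclideanSpace.single (Fin.last d) (t * g x)) * hκm.mk κ t) ?_
    exact (hfm.stronglyMeasurable_mk.comp_measurable (by fun_prop)).mul
      (hκm.stronglyMeasurable_mk.comp_measurable measurable_snd)
  · filter_upwards [hfg] with x hx
    refine integral_congr_ae ?_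
    filter_upwards [hx, hκm.ae_eq_mk] with t ht ht2
    rw [ht, ht2]

lemma lintegral_vertInt_le (h : IsScale φ τ K g) (hφ : Continuous φ) (hτ : 0 < τ)
    (hK : 0 < K) (hg : Measurable g) (hκ : ∀ t, 1 ≤ t → |κ t| ≤ C / t ^ 2) {p : ℝ} (hp : 1 ≤ p)
    {f : Euc (d + 1) → ℝ} (hfm : AEStronglyMeasurable f (volume.restrict (above φ))) :
    ∫⁻ x in below φ, ‖vertInt g κ f x‖ₑ ^ p ≤
      ENNReal.ofReal (C * (K * p / ((p + 1) * τ ^ (1 + 1 / p)))) ^ p *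
        ∫⁻ x in above φ, ‖f x‖ₑ ^ p := by
  have hp0 : 0 < p := by linarith
  have hC : 0 ≤ C := by
    have := (abs_nonneg _).trans (hκ 1 le_rfl); simpa using this
  calc _ ≤ ∫⁻ x in below φ, ENNReal.ofReal C ^ p * vertAvg g (fun y => ‖f y‖ₑ) x ^ p := by
        refine lintegral_mono fun x => ?_
        rw [← ENNReal.mul_rpow_of_nonneg _ _ hp0.le]
        gcongr
        exact enorm_vertInt_le hκ f x
    _ ≤ _ := by
        rw [lintegral_const_mul' _ _ (ENNReal.rpow_ne_top_of_nonneg hp0.le ENNReal.ofReal_ne_top),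
          ENNReal.ofReal_mul hC, ENNReal.mul_rpow_of_nonneg _ _ hp0.le, mul_assoc]
        gcongr
        exact h.lintegral_vertAvg_le' hφ hτ hK hg hp hfm.enorm

lemma IsScale.eLpNorm_vertInt_le (h : IsScale φ τ K g) (hφ : Continuous φ) (hτ : 0 < τ)
    (hK : 0 < K) (hg : Measurable g) (hκ : ∀ t, 1 ≤ t → |κ t| ≤ C / t ^ 2) {p : ℝ} (hp : 1 ≤ p)
    {f : Euc (d + 1) → ℝ} (hfm : AEStronglyMeasurable f (volume.restrict (above φ))) :
    eLpNorm (vertInt g κ f) (ENNReal.ofReal p) (volume.restrict (below φ)) ≤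
      ENNReal.ofReal (C * (K * p / ((p + 1) * τ ^ (1 + 1 / p)))) *
        eLpNorm f (ENNReal.ofReal p) (volume.restrict (above φ)) := by
  have hp0 : 0 < p := by linarith
  rw [← ENNReal.rpow_le_rpow_iff hp0, ENNReal.mul_rpow_of_nonneg _ _ hp0.le,
    eLpNorm_ofReal_rpow _ _ hp, eLpNorm_ofReal_rpow _ _ hp]
  exact lintegral_vertInt_le h hφ hτ hK hg hκ hp hfm

lemma IsScale.memLp_vertInt (h : IsScale φ τ K g) (hφ : Continuous φ) (hτ : 0 < τ)
    (hK : 0 < K) (hg : Measurable g) (hκ : ∀ t, 1 ≤ t → |κ t| ≤ C / t ^ 2)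
    (hκm : AEStronglyMeasurable κ (volume.restrict (Ioi 1))) {r : ℝ} (hr : 1 ≤ r)
    {f : Euc (d + 1) → ℝ} (hf : MemLp f (ENNReal.ofReal r) (volume.restrict (above φ))) :
    MemLp (vertInt g κ f) (ENNReal.ofReal r) (volume.restrict (below φ)) :=
  ⟨h.aestronglyMeasurable_vertInt hφ hτ hK hg hκm hf.1,
    (h.eLpNorm_vertInt_le hφ hτ hK hg hκ hr hf.1).trans_lt
      (ENNReal.mul_lt_top ENNReal.ofReal_lt_top hf.2)⟩

lemma IsScale.vertInt_sub (h : IsScale φ τ K g) (hφ : Continuous φ) (hτ : 0 < τ)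
    (hK : 0 < K) (hg : Measurable g) (hκ : ∀ t, 1 ≤ t → |κ t| ≤ C / t ^ 2)
    (hκm : AEStronglyMeasurable κ (volume.restrict (Ioi 1))) {r : ℝ} (hr : 1 ≤ r)
    {f₁ f₂ : Euc (d + 1) → ℝ} (hf₁ : MemLp f₁ (ENNReal.ofReal r) (volume.restrict (above φ)))
    (hf₂ : MemLp f₂ (ENNReal.ofReal r) (volume.restrict (above φ))) :
    vertInt g κ (f₁ - f₂) =ᵐ[volume.restrict (below φ)] vertInt g κ f₁ - vertInt g κ f₂ := by
  filter_upwards [h.ae_integrable hφ hτ hK hg hκ hκm hr hf₁,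
    h.ae_integrable hφ hτ hK hg hκ hκm hr hf₂] with x h1 h2
  simp only [vertInt, Pi.sub_apply, sub_mul]
  exact integral_sub h1 h2

end

/-! ### Mollification -/

section
variable {n : ℕ}

/-- The convolution `ρ ⋆ f`. -/
def mollify (ρ f : Euc n → ℝ) : Euc n → ℝ :=
  convolution ρ f (ContinuousLinearMap.lsmul ℝ ℝ) volume

lemma mollify_apply (ρ f : Euc n → ℝ) (x : Euc n) :
    mollify ρ f x = ∫ y, ρ y * f (x - y) := by
  simp [mollify, convolution_def]

/-- Translations act continuously on `L^r`. -/
lemma tendsto_eLpNorm_translate {q : ℝ≥0∞} (hq1 : 1 ≤ q) (hq : q ≠ ⊤) {f : Euc n → ℝ}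
    (hf : MemLp f q volume) :
    Tendsto (fun y => eLpNorm (fun x => f (x - y) - f x) q volume) (𝓝 0) (𝓝 0) := by
  have : Fact (1 ≤ q) := ⟨hq1⟩
  let T : C(Euc n, C(Euc n, Euc n)) :=
    (ContinuousMap.mk (fun a : Euc n × Euc n => a.2 - a.1) (by fun_prop)).curry
  have hT : ∀ y, MeasurePreserving (T y) volume volume := fun y =>
    measurePreserving_sub_right volume y
  have hc : Continuous fun y => Lp.compMeasurePreserving (T y) (hT y) (hf.toLp f) :=
    continuous_const.compMeasurePreservingLp T.continuous hT hq
  have h0 : Lp.compMeasurePreserving (T 0) (hT 0) (hf.toLp f) = hf.toLp f := by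
    rw [Lp.toLp_compMeasurePreserving]
    congr 1
    ext x
    simp [T]
  have h1 := (hc.tendsto 0)
  rw [h0, tendsto_iff_edist_tendsto_0] at h1
  refine h1.congr fun y => ?_
  rw [Lp.toLp_compMeasurePreserving, Lp.edist_toLp_toLp]
  rfl

lemma mollify_congr (ρ : Euc n → ℝ) {f f' : Euc n → ℝ} (h : f =ᵐ[volume] f') :
    mollify ρ f = mollify ρ f' :=
  convolution_congr _ (ae_eq_refl ρ) h

/-- The distance in `L^r` of `f` to an average of translates of `f` is at most the largest
distance of `f` to one of the translates: Jensen's inequality for the probability density `ρ`. -/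
lemma eLpNorm_mollify_sub_le {ρ : Euc n → ℝ} (hρ : Continuous ρ) (hρs : HasCompactSupport ρ)
    (hρ0 : ∀ y, 0 ≤ ρ y) (hρ1 : ∫ y, ρ y = 1) {r : ℝ} (hr : 1 ≤ r) {f : Euc n → ℝ}
    (hf : MemLp f (ENNReal.ofReal r) volume) {ε : ℝ≥0∞}
    (h : ∀ y, ρ y ≠ 0 → eLpNorm (fun x => f (x - y) - f x) (ENNReal.ofReal r) volume ≤ ε) :
    eLpNorm (mollify ρ f - f) (ENNReal.ofReal r) volume ≤ ε := by
  have hr0 : 0 < r := by linarith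
  have hr1 : 1 ≤ ENNReal.ofReal r := by simpa using ENNReal.ofReal_le_ofReal hr
  wlog hm : StronglyMeasurable f generalizing f
  · have e := hf.1.ae_eq_mk
    have h1 : mollify ρ f - f =ᵐ[volume] mollify ρ (hf.1.mk f) - hf.1.mk f := by
      rw [mollify_congr ρ e]
      filter_upwards [e] with x hx
      simp [hx]
    rw [eLpNorm_congr_ae h1]
    refine this (hf.ae_eq e) (fun y hy => ?_) hf.1.stronglyMeasurable_mk
    refine le_of_eq_of_le (eLpNorm_congr_ae ?_) (h y hy)
    have e' := (measurePreserving_sub_right volume y).quasiMeasurePreserving.ae_eq_comp e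
    filter_upwards [e, e'] with x hx hx'
    simp only [Function.comp_apply] at hx'
    rw [hx, hx']
  have hfl : LocallyIntegrable f volume := hf.locallyIntegrable hr1
  set w : Euc n → ℝ≥0∞ := fun y => ENNReal.ofReal (ρ y) with hw
  have hwm : Measurable w := by fun_prop
  have hρi : Integrable ρ := hρ.integrable_of_hasCompactSupport hρs
  have hw1 : ∫⁻ y, w y = 1 := by
    rw [← ofReal_integral_eq_lintegral_ofReal hρi (Eventually.of_forall hρ0), hρ1,
      ENNReal.ofReal_one]
  set ν := (volume : Measure (Euc n)).withDensity w with hν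
  have hν1 : ν univ = 1 := by
    rw [hν, withDensity_apply _ MeasurableSet.univ, Measure.restrict_univ, hw1]
  have hfm : Measurable f := hm.measurable
  have hpt : ∀ x, ‖(mollify ρ f - f) x‖ₑ ^ r ≤ ∫⁻ y, w y * ‖f (x - y) - f x‖ₑ ^ r := by
    intro x
    have hi : Integrable fun y => ρ y * f (x - y) :=
      (hρs.convolutionExists_left (ContinuousLinearMap.lsmul ℝ ℝ) hρ hfl x).integrable
    have e : (mollify ρ f - f) x = ∫ y, ρ y * (f (x - y) - f x) := by
      simp only [mul_sub]
      rw [integral_sub hi (hρi.mul_const _), integral_mul_const, hρ1, one_mul, Pi.sub_apply,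
        mollify_apply]
    calc ‖(mollify ρ f - f) x‖ₑ ^ r ≤ (∫⁻ y, ‖f (x - y) - f x‖ₑ ∂ν) ^ r := by
          gcongr
          rw [e, hν, lintegral_withDensity_eq_lintegral_mul _ hwm (by fun_prop)]
          refine (enorm_integral_le_lintegral_enorm _).trans (le_of_eq ?_)
          refine lintegral_congr fun y => ?_
          rw [enorm_mul, Real.enorm_of_nonneg (hρ0 y)]
          rfl
      _ ≤ ν univ ^ (r - 1) * ∫⁻ y, ‖f (x - y) - f x‖ₑ ^ r ∂ν :=
          lintegral_rpow_le_measure_univ_mul ν (by fun_prop) hr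
      _ = _ := by
          rw [hν1, ENNReal.one_rpow, one_mul, hν,
            lintegral_withDensity_eq_lintegral_mul _ hwm (by fun_prop)]
          rfl
  rw [← ENNReal.rpow_le_rpow_iff hr0, eLpNorm_ofReal_rpow _ _ hr]
  calc _ ≤ ∫⁻ x, ∫⁻ y, w y * ‖f (x - y) - f x‖ₑ ^ r := lintegral_mono hpt
    _ = ∫⁻ y, w y * ∫⁻ x, ‖f (x - y) - f x‖ₑ ^ r := by
        rw [lintegral_lintegral_swap (by fun_prop)]
        refine lintegral_congr fun y => ?_
        rw [lintegral_const_mul _ (by fun_prop)]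
    _ ≤ ∫⁻ y, w y * ε ^ r := by
        refine lintegral_mono fun y => ?_
        by_cases hy : ρ y = 0
        · simp [hw, hy]
        · dsimp only
          gcongr
          rw [← eLpNorm_ofReal_rpow volume (fun x => f (x - y) - f x) hr]
          gcongr
          exact h y hy
    _ = ε ^ r := by rw [lintegral_mul_const _ hwm, hw1, one_mul]

lemma memLp_mollify {ρ : Euc n → ℝ} (hρ : ContDiff ℝ ∞ ρ) (hρs : HasCompactSupport ρ)
    (hρ0 : ∀ y, 0 ≤ ρ y) (hρ1 : ∫ y, ρ y = 1) {r : ℝ} (hr : 1 ≤ r) {f : Euc n → ℝ}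
    (hf : MemLp f (ENNReal.ofReal r) volume) :
    MemLp (mollify ρ f) (ENNReal.ofReal r) volume := by
  have hr1 : 1 ≤ ENNReal.ofReal r := by simpa using ENNReal.ofReal_le_ofReal hr
  have hsub : MemLp (mollify ρ f - f) (ENNReal.ofReal r) volume := by
    refine ⟨(hρs.contDiff_convolution_left _ hρ
      (hf.locallyIntegrable hr1)).continuous.aestronglyMeasurable.sub hf.1, ?_⟩
    refine (eLpNorm_mollify_sub_le (ε := eLpNorm f (ENNReal.ofReal r) volume +
      eLpNorm f (ENNReal.ofReal r) volume) hρ.continuous hρs hρ0 hρ1 hr hf fun y _ => ?_).trans_lt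
      (ENNReal.add_lt_top.2 ⟨hf.2, hf.2⟩)
    have hT := measurePreserving_sub_right (volume : Measure (Euc n)) y
    refine (eLpNorm_sub_le (hf.comp_measurePreserving hT).1 hf.1 hr1).trans_eq ?_
    rw [eLpNorm_comp_measurePreserving hf.1 hT]
  simpa using hsub.add hf

/-- Mollifiers whose supports shrink to the origin approximate the identity in `L^r`. -/
lemma tendsto_eLpNorm_mollify_sub {ρ : ℕ → Euc n → ℝ} (hρ : ∀ k, Continuous (ρ k))
    (hρs : ∀ k, HasCompactSupport (ρ k)) (hρ0 : ∀ k y, 0 ≤ ρ k y) (hρ1 : ∀ k, ∫ y, ρ k y = 1)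
    {R : ℕ → ℝ} (hR : Tendsto R atTop (𝓝 0)) (hρR : ∀ k y, ρ k y ≠ 0 → ‖y‖ ≤ R k)
    {r : ℝ} (hr : 1 ≤ r) {f : Euc n → ℝ} (hf : MemLp f (ENNReal.ofReal r) volume) :
    Tendsto (fun k => eLpNorm (mollify (ρ k) f - f) (ENNReal.ofReal r) volume) atTop (𝓝 0) := by
  have hr1 : 1 ≤ ENNReal.ofReal r := by simpa using ENNReal.ofReal_le_ofReal hr
  rw [ENNReal.tendsto_nhds_zero]
  intro ε hε
  have h := (ENNReal.tendsto_nhds_zero.1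
    (tendsto_eLpNorm_translate hr1 ENNReal.ofReal_ne_top hf)) ε hε
  obtain ⟨s, hs, hs'⟩ := Metric.eventually_nhds_iff.1 h
  filter_upwards [hR.eventually_lt_const hs] with k hk
  refine eLpNorm_mollify_sub_le (hρ k) (hρs k) (hρ0 k) (hρ1 k) hr hf fun y hy => hs' ?_
  rw [dist_zero_right]
  exact (hρR k y hy).trans_lt hk

lemma contDiff_mollify {ρ f : Euc n → ℝ} (hρ : ContDiff ℝ ∞ ρ) (hρs : HasCompactSupport ρ)
    (hf : LocallyIntegrable f volume) : ContDiff ℝ ∞ (mollify ρ f) :=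
  hρs.contDiff_convolution_left _ hρ hf

lemma fderiv_mollify_apply {ρ f : Euc n → ℝ} (hρ : ContDiff ℝ ∞ ρ) (hρs : HasCompactSupport ρ)
    (hf : LocallyIntegrable f volume) (x e : Euc n) :
    fderiv ℝ (mollify ρ f) x e = ∫ y, fderiv ℝ ρ y e * f (x - y) := by
  have h1 : ContDiff ℝ 1 ρ := hρ.of_le (by simp)
  have hd := (hρs.hasFDerivAt_convolution_left (ContinuousLinearMap.lsmul ℝ ℝ) h1 hf x).fderiv
  have hi := ((hρs.fderiv ℝ).convolutionExists_left ((ContinuousLinearMap.lsmul ℝ ℝ).precompL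
    (Euc n)) (h1.continuous_fderiv one_ne_zero) hf x).integrable
  rw [mollify, hd, convolution_def, ContinuousLinearMap.integral_apply hi]
  simp [ContinuousLinearMap.precompL_apply]

/-- The mollification of an `L^r` function is Lipschitz: `|∇ρ| |f| ≤ |∇ρ| (1 + |f|^r)`. -/
lemma exists_lipschitzWith_mollify {ρ f : Euc n → ℝ} (hρ : ContDiff ℝ ∞ ρ)
    (hρs : HasCompactSupport ρ) {r : ℝ} (hr : 1 ≤ r) (hf : MemLp f (ENNReal.ofReal r) volume) :
    ∃ L, LipschitzWith L (mollify ρ f) := by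
  have hr0 : 0 < r := by linarith
  have hr1 : 1 ≤ ENNReal.ofReal r := by simpa using ENNReal.ofReal_le_ofReal hr
  have hfl : LocallyIntegrable f volume := hf.locallyIntegrable hr1
  have hρ' : Continuous (fderiv ℝ ρ) := hρ.continuous_fderiv (by simp)
  obtain ⟨D, hD⟩ := (hρs.fderiv ℝ).exists_bound_of_continuous hρ'
  have hi : Integrable (fderiv ℝ ρ) := hρ'.integrable_of_hasCompactSupport (hρs.fderiv ℝ)
  have hBt : (∫⁻ y, ‖fderiv ℝ ρ y‖ₑ) + ENNReal.ofReal D * ∫⁻ y, ‖f y‖ₑ ^ r ≠ ⊤ := by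
    refine ENNReal.add_ne_top.2 ⟨hi.2.ne, ENNReal.mul_ne_top ENNReal.ofReal_ne_top ?_⟩
    rw [← eLpNorm_ofReal_rpow _ _ hr]
    exact ENNReal.rpow_ne_top_of_nonneg hr0.le hf.eLpNorm_ne_top
  have hkey : ∀ x, ∫⁻ y, ‖fderiv ℝ ρ y‖ₑ * ‖f (x - y)‖ₑ ≤
      (∫⁻ y, ‖fderiv ℝ ρ y‖ₑ) + ENNReal.ofReal D * ∫⁻ y, ‖f y‖ₑ ^ r := by
    intro x
    rw [← lintegral_sub_left_eq_self (fun y => ‖f y‖ₑ ^ r) x,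
      ← lintegral_const_mul' _ _ ENNReal.ofReal_ne_top, ← lintegral_add_left (by fun_prop)]
    refine lintegral_mono fun y => ?_
    have h1 : ‖f (x - y)‖ₑ ≤ 1 + ‖f (x - y)‖ₑ ^ r := by
      rcases le_total ‖f (x - y)‖ₑ 1 with h | h
      · exact h.trans le_self_add
      · exact (ENNReal.le_rpow_self_of_one_le h hr).trans le_add_self
    calc _ ≤ ‖fderiv ℝ ρ y‖ₑ * (1 + ‖f (x - y)‖ₑ ^ r) := by gcongr
      _ = ‖fderiv ℝ ρ y‖ₑ + ‖fderiv ℝ ρ y‖ₑ * ‖f (x - y)‖ₑ ^ r := by rw [mul_add, mul_one]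
      _ ≤ _ := by
        gcongr
        rw [← ofReal_norm]
        exact ENNReal.ofReal_le_ofReal (hD y)
  set c := (∫⁻ y, ‖fderiv ℝ ρ y‖ₑ) + ENNReal.ofReal D * ∫⁻ y, ‖f y‖ₑ ^ r
  refine ⟨c.toNNReal, lipschitzWith_of_nnnorm_fderiv_le
    ((contDiff_mollify hρ hρs hfl).differentiable (by simp)) fun x => ?_⟩
  rw [← NNReal.coe_le_coe, coe_nnnorm]
  refine ContinuousLinearMap.opNorm_le_bound _ (by positivity) fun e => ?_
  rw [fderiv_mollify_apply hρ hρs hfl, ← ENNReal.ofReal_le_ofReal_iff (by positivity),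
    ofReal_norm, ENNReal.ofReal_mul (by positivity), ofReal_norm,
    ENNReal.coe_toNNReal_eq_toReal, ENNReal.ofReal_toReal hBt]
  refine (enorm_integral_le_lintegral_enorm _).trans ?_
  refine le_trans ?_ (mul_le_mul_left (hkey x) _)
  rw [← lintegral_mul_const' _ _ (by simp)]
  refine lintegral_mono fun y => ?_
  rw [enorm_mul, mul_right_comm]
  gcongr
  exact ContinuousLinearMap.le_opENorm _ _

/-- Mollification commutes with weak differentiation at the points `x` for which `x - supp ρ` lies
in the domain. -/
lemma IsWeakGrad.partialDeriv_mollify {Ω : Set (Euc n)} (hΩ : MeasurableSet Ω)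
    {u : Euc n → ℝ} {G : Fin n → Euc n → ℝ} (h : IsWeakGrad Ω u G) {ρ : Euc n → ℝ}
    (hρ : ContDiff ℝ ∞ ρ) (hρs : HasCompactSupport ρ)
    (hu : LocallyIntegrable (Ω.indicator u) volume) {x : Euc n}
    (hx : ∀ y ∈ tsupport ρ, x - y ∈ Ω) (j : Fin n) :
    partialDeriv j (mollify ρ (Ω.indicator u)) x = mollify ρ (Ω.indicator (G j)) x := by
  have hη : ContDiff ℝ ∞ (fun z => ρ (x - z)) := by fun_prop
  have hηt : tsupport (fun z => ρ (x - z)) ⊆ Ω := by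
    intro z hz
    have : x - z ∈ tsupport ρ :=
      tsupport_comp_subset_preimage ρ (f := fun z => x - z) (by fun_prop) hz
    simpa using hx _ this
  have hηs : HasCompactSupport (fun z => ρ (x - z)) :=
    hρs.comp_homeomorph (Homeomorph.subLeft x)
  have key := (h.2 j).2 _ hη hηs hηt
  have hd : ∀ z, partialDeriv j (fun z => ρ (x - z)) z =
      -fderiv ℝ ρ (x - z) (EuclideanSpace.single j 1) := by
    intro z
    have h1 : HasFDerivAt (fun z => x - z) (-ContinuousLinearMap.id ℝ (Euc n)) z := by
      simpa using (hasFDerivAt_id z).const_sub x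
    have h2 := ((hρ.differentiable (by simp)).differentiableAt.hasFDerivAt
      (x := x - z)).comp z h1
    rw [partialDeriv, show (fun z => ρ (x - z)) = ρ ∘ fun z => x - z from rfl, h2.fderiv]
    simp
  simp only [hd, mul_neg, integral_neg, neg_inj] at key
  rw [partialDeriv, fderiv_mollify_apply hρ hρs hu, mollify_apply,
    ← integral_sub_left_eq_self _ volume x, ← integral_sub_left_eq_self
      (fun y => ρ y * Ω.indicator (G j) (x - y)) volume x]
  simp only [sub_sub_cancel]
  have e : ∀ (a v : Euc n → ℝ), ∫ z, a (x - z) * Ω.indicator v z = ∫ z in Ω, v z * a (x - z) := by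
    intro a v
    rw [← integral_indicator hΩ]
    refine integral_congr_ae (Eventually.of_forall fun z => ?_)
    by_cases hz : z ∈ Ω <;> simp [hz, mul_comm]
  rw [e (fun y => fderiv ℝ ρ y (EuclideanSpace.single j 1)), e ρ, key]

lemma integrable_mul_of_memLp {r : ℝ} (hr : 1 ≤ r) {μ : Measure (Euc n)}
    [IsFiniteMeasureOnCompacts μ] {η : Euc n → ℝ} (hη : Continuous η) (hηs : HasCompactSupport η)
    {f : Euc n → ℝ} (hf : MemLp f (ENNReal.ofReal r) μ) : Integrable (fun x => f x * η x) μ := by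
  have hr1 : 1 ≤ ENNReal.ofReal r := by simpa using ENNReal.ofReal_le_ofReal hr
  have := (ENNReal.HolderConjugate.conjExponent hr1).symm
  have h := hf.smul (r := 1) (hη.memLp_of_hasCompactSupport (p := (ENNReal.ofReal r).conjExponent)
    (μ := μ) hηs)
  refine memLp_one_iff_integrable.1 (h.ae_eq (Eventually.of_forall fun x => ?_))
  simp [mul_comm]

/-- Convergence in `L^r` implies convergence of the integrals against a fixed continuous function
of compact support. -/
lemma tendsto_integral_mul_of_eLpNorm {r : ℝ} (hr : 1 ≤ r) {μ : Measure (Euc n)}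
    [IsFiniteMeasureOnCompacts μ] {η : Euc n → ℝ} (hη : Continuous η) (hηs : HasCompactSupport η)
    {F : ℕ → Euc n → ℝ} {f : Euc n → ℝ} (hF : ∀ k, MemLp (F k) (ENNReal.ofReal r) μ)
    (hf : MemLp f (ENNReal.ofReal r) μ)
    (h : Tendsto (fun k => eLpNorm (F k - f) (ENNReal.ofReal r) μ) atTop (𝓝 0)) :
    Tendsto (fun k => ∫ x, F k x * η x ∂μ) atTop (𝓝 (∫ x, f x * η x ∂μ)) := by
  have hr1 : 1 ≤ ENNReal.ofReal r := by simpa using ENNReal.ofReal_le_ofReal hr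
  have := (ENNReal.HolderConjugate.conjExponent hr1).symm
  set q := (ENNReal.ofReal r).conjExponent
  have hηq : MemLp η q μ := hη.memLp_of_hasCompactSupport hηs
  have hi : ∀ {f : Euc n → ℝ}, MemLp f (ENNReal.ofReal r) μ → Integrable (fun x => f x * η x) μ :=
    fun hf => integrable_mul_of_memLp hr hη hηs hf
  refine tendsto_integral_of_L1' _ (hi hf).1 (Eventually.of_forall fun k => hi (hF k)) ?_
  have hb : Tendsto (fun k => eLpNorm η q μ * eLpNorm (F k - f) (ENNReal.ofReal r) μ)
      atTop (𝓝 0) := by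
    simpa using ENNReal.Tendsto.const_mul h (Or.inr hηq.eLpNorm_ne_top)
  refine tendsto_of_tendsto_of_tendsto_of_le_of_le tendsto_const_nhds hb (fun _ => zero_le)
    fun k => ?_
  have := eLpNorm_smul_le_mul_eLpNorm (r := 1) (p := q) (q := ENNReal.ofReal r) ((hF k).sub hf).1 hηq.1
  refine le_of_eq_of_le (eLpNorm_congr_ae (Eventually.of_forall fun x => ?_)) this
  simp [mul_sub, mul_comm]

end

/-! ### The extension of smooth functions -/

/-- A function vanishing on `S`, with at most linear growth away from `S` and bounded derivative
off `S`, is Lipschitz. Two points closer to each other than to `S` lie in a ball that avoids `S`;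
for all others the growth bound suffices. -/
lemma lipschitzWith_of_infDist {E : Type*} [NormedAddCommGroup E] [NormedSpace ℝ E] {S : Set E}
 {f : E → ℝ} {C₁ C₂ : ℝ≥0} (h0 : ∀ x ∈ S, f x = 0)
    (h1 : ∀ x ∉ S, |f x| ≤ C₁ * Metric.infDist x S)
    (hd : ∀ x ∉ S, DifferentiableAt ℝ f x) (h2 : ∀ x ∉ S, ‖fderiv ℝ f x‖ ≤ C₂) :
    LipschitzWith (3 * C₁ + C₂) f := by
  have h1' : ∀ x, |f x| ≤ C₁ * Metric.infDist x S := by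
    intro x
    by_cases hx : x ∈ S
    · rw [h0 x hx, abs_zero]
      exact mul_nonneg C₁.2 Metric.infDist_nonneg
    · exact h1 x hx
  refine LipschitzWith.of_dist_le_mul fun x y => ?_
  push_cast
  have hxy : 0 ≤ dist x y := dist_nonneg
  have hC1 : (0 : ℝ) ≤ C₁ := C₁.2
  have hC2 : (0 : ℝ) ≤ C₂ := C₂.2
  rcases lt_or_ge (dist x y) (Metric.infDist x S) with h | h
  · have hball : ∀ z ∈ Metric.ball x (Metric.infDist x S), z ∉ S := by
      intro z hz hzS
      have := Metric.infDist_le_dist_of_mem (x := x) hzS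
      rw [Metric.mem_ball, dist_comm] at hz
      linarith
    have key := (convex_ball x (Metric.infDist x S)).norm_image_sub_le_of_norm_fderiv_le (𝕜 := ℝ)
      (f := f) (fun z hz => hd z (hball z hz)) (fun z hz => h2 z (hball z hz))
      (x := y) (y := x) (by rwa [Metric.mem_ball, dist_comm])
      (Metric.mem_ball_self (hxy.trans_lt h))
    rw [dist_eq_norm, dist_eq_norm]
    refine key.trans ?_
    gcongr
    linarith
  · have hy : Metric.infDist y S ≤ Metric.infDist x S + dist y x := Metric.infDist_le_infDist_add_dist
    rw [dist_comm y x] at hy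
    rw [Real.dist_eq]
    calc |f x - f y| ≤ |f x| + |f y| := abs_sub _ _
      _ ≤ C₁ * Metric.infDist x S + C₁ * Metric.infDist y S := add_le_add (h1' x) (h1' y)
      _ ≤ C₁ * dist x y + C₁ * (2 * dist x y) := by gcongr; linarith
      _ ≤ _ := by nlinarith

section
variable {d : ℕ} {φ : Euc d → ℝ} {g : Euc (d + 1) → ℝ} {ψ : ℝ → ℝ} {v : Euc (d + 1) → ℝ}
  {L Lg : ℝ≥0}

lemma integrableOn_comp_vertical (hψ0 : IntegrableOn ψ (Ioi 1))
    (hψ1 : IntegrableOn (fun t => t * ψ t) (Ioi 1)) (hv : LipschitzWith L v) (x : Euc (d + 1))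
    (c : ℝ) :
    IntegrableOn (fun t => v (x + EuclideanSpace.single (Fin.last d) (t * c)) * ψ t) (Ioi 1) := by
  have hcont : Continuous fun t => v (x + EuclideanSpace.single (Fin.last d) (t * c)) :=
    hv.continuous.comp (continuous_const.add (continuous_single_last.comp (by fun_prop)))
  refine Integrable.mono' (g := fun t => |v x| * |ψ t| + L * |c| * |t * ψ t|)
    ((hψ0.norm.const_mul _).add (hψ1.norm.const_mul _))
    (hcont.aestronglyMeasurable.mul hψ0.aestronglyMeasurable) (Eventually.of_forall fun t => ?_)
  have h1 := hv.dist_le_mul (x + EuclideanSpace.single (Fin.last d) (t * c)) x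
  rw [dist_eq_norm, dist_eq_norm, add_sub_cancel_left, PiLp.norm_single,
    Real.norm_eq_abs, Real.norm_eq_abs, abs_mul] at h1
  have h2 : |v (x + EuclideanSpace.single (Fin.last d) (t * c))| ≤ |v x| + L * (|t| * |c|) := by
    have := abs_sub_abs_le_abs_sub (v (x + EuclideanSpace.single (Fin.last d) (t * c))) (v x)
    linarith
  rw [Real.norm_eq_abs, abs_mul, abs_mul]
  calc _ ≤ (|v x| + L * (|t| * |c|)) * |ψ t| := by gcongr
    _ = _ := by ring

lemma abs_vertical_sub_le (hv : LipschitzWith L v) (hg : LipschitzWith Lg g) {t : ℝ} (ht : 0 ≤ t)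
    (x y : Euc (d + 1)) :
    |v (x + EuclideanSpace.single (Fin.last d) (t * g x)) -
      v (y + EuclideanSpace.single (Fin.last d) (t * g y))| ≤ L * (1 + t * Lg) * dist x y := by
  have h1 := hv.dist_le_mul (x + EuclideanSpace.single (Fin.last d) (t * g x))
    (y + EuclideanSpace.single (Fin.last d) (t * g y))
  rw [Real.dist_eq] at h1
  refine h1.trans ?_
  rw [mul_assoc]
  gcongr
  refine (dist_add_add_le _ _ _ _).trans ?_
  have h2 : dist (EuclideanSpace.single (Fin.last d) (t * g x) : Euc (d + 1))
      (EuclideanSpace.single (Fin.last d) (t * g y)) = t * dist (g x) (g y) := by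
    rw [single_last_eq_smul (t * g x), single_last_eq_smul (t * g y), dist_eq_norm, ← sub_smul,
      norm_smul, PiLp.norm_single, norm_one, mul_one, ← mul_sub, norm_mul,
      Real.norm_of_nonneg ht, dist_eq_norm]
  rw [h2, add_mul, one_mul, mul_assoc]
  gcongr
  exact hg.dist_le_mul x y

/-- The constant of the Lipschitz bound for `v ↦ v (x + t g(x) eₙ) ψ(t)` is integrable in `t`. -/
lemma integrableOn_lipschitz_bound (hψ0 : IntegrableOn ψ (Ioi 1))
    (hψ1 : IntegrableOn (fun t => t * ψ t) (Ioi 1)) (L Lg : ℝ≥0) :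
    IntegrableOn (fun t => L * (1 + t * Lg) * |ψ t|) (Ioi 1) := by
  have := (hψ0.norm.const_mul (L : ℝ)).add (hψ1.norm.const_mul (L * Lg : ℝ))
  refine this.congr ?_
  filter_upwards [ae_restrict_mem measurableSet_Ioi] with t ht
  have ht0 : (0 : ℝ) < t := one_pos.trans ht
  simp only [Pi.add_apply, Real.norm_eq_abs, abs_mul, abs_of_pos ht0]
  ring

lemma exists_lipschitzWith_vertInt (hψ0 : IntegrableOn ψ (Ioi 1))
    (hψ1 : IntegrableOn (fun t => t * ψ t) (Ioi 1)) (hv : LipschitzWith L v)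
    (hg : LipschitzWith Lg g) : ∃ C, LipschitzWith C (vertInt g ψ v) := by
  have hb := integrableOn_lipschitz_bound hψ0 hψ1 L Lg
  refine ⟨(∫ t in Ioi 1, L * (1 + t * Lg) * |ψ t|).toNNReal, LipschitzWith.of_dist_le_mul
    fun x y => ?_⟩
  have hb0 : 0 ≤ ∫ t in Ioi 1, L * (1 + t * Lg) * |ψ t| := by
    refine setIntegral_nonneg measurableSet_Ioi fun t ht => ?_
    have ht0 : (0 : ℝ) < t := one_pos.trans ht
    positivity
  rw [Real.coe_toNNReal _ hb0, dist_eq_norm, vertInt, vertInt, ← integral_sub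
    (integrableOn_comp_vertical hψ0 hψ1 hv x (g x))
    (integrableOn_comp_vertical hψ0 hψ1 hv y (g y)), ← integral_mul_const]
  refine norm_integral_le_of_norm_le (hb.mul_const _) ?_
  filter_upwards [ae_restrict_mem measurableSet_Ioi] with t ht
  rw [← sub_mul, Real.norm_eq_abs, abs_mul, mul_right_comm]
  gcongr
  exact abs_vertical_sub_le hv hg (one_pos.trans ht).le x y

lemma partialDeriv_add_smul {p e : Euc (d + 1)} (j : Fin (d + 1)) (c : ℝ)
    (he : e = EuclideanSpace.single j 1 + EuclideanSpace.single (Fin.last d) c) :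
    fderiv ℝ v p e = partialDeriv j v p + c * partialDeriv (Fin.last d) v p := by
  rw [he, map_add, single_last_eq_smul, map_smul]
  rfl

/-- Differentiation under the integral sign, where `g` is differentiable. -/
lemma hasLineDerivAt_vertInt (hψ0 : IntegrableOn ψ (Ioi 1))
    (hψ1 : IntegrableOn (fun t => t * ψ t) (Ioi 1)) (hv : LipschitzWith L v)
    (hvd : ContDiff ℝ ∞ v) (hg : LipschitzWith Lg g) {x : Euc (d + 1)}
    (hgx : DifferentiableAt ℝ g x) (j : Fin (d + 1)) :
    HasLineDerivAt ℝ (vertInt g ψ v) (vertInt g ψ (partialDeriv j v) x +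
      partialDeriv j g x * vertInt g (fun t => t * ψ t) (partialDeriv (Fin.last d) v) x) x
      (EuclideanSpace.single j 1) := by
  set e : Euc (d + 1) := EuclideanSpace.single j 1 with he
  have hpc : ∀ i, Continuous (partialDeriv i v) := fun i =>
    (hvd.continuous_fderiv (by simp)).clm_apply continuous_const
  have hpb : ∀ i y, ‖partialDeriv i v y‖ ≤ L := by
    intro i y
    have h1 := (fderiv ℝ v y).le_opNorm (EuclideanSpace.single i 1)
    rw [PiLp.norm_single, norm_one, mul_one] at h1
    exact h1.trans (norm_fderiv_le_of_lipschitz ℝ hv)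
  have hcomp : ∀ i, Continuous fun t =>
      partialDeriv i v (x + EuclideanSpace.single (Fin.last d) (t * g x)) := fun i =>
    (hpc i).comp (continuous_const.add (continuous_single_last.comp (by fun_prop)))
  have hI : ∀ i (κ : ℝ → ℝ), IntegrableOn κ (Ioi 1) → IntegrableOn (fun t =>
      partialDeriv i v (x + EuclideanSpace.single (Fin.last d) (t * g x)) * κ t) (Ioi 1) :=
    fun i κ hκ => hκ.bdd_mul (hcomp i).aestronglyMeasurable
      (Eventually.of_forall fun t => hpb i _)
  have key := (hasDerivAt_integral_of_dominated_loc_of_lip (μ := volume.restrict (Ioi (1 : ℝ)))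
    (F := fun (h : ℝ) t => v ((x + h • e) + EuclideanSpace.single (Fin.last d)
      (t * g (x + h • e))) * ψ t)
    (F' := fun t => partialDeriv j v (x + EuclideanSpace.single (Fin.last d) (t * g x)) * ψ t +
      partialDeriv j g x * (partialDeriv (Fin.last d) v
        (x + EuclideanSpace.single (Fin.last d) (t * g x)) * (t * ψ t)))
    (x₀ := 0) (bound := fun t => L * (1 + t * Lg) * |ψ t|) univ_mem
    (Eventually.of_forall fun h =>
      (integrableOn_comp_vertical hψ0 hψ1 hv _ (g (x + h • e))).aestronglyMeasurable)
    (integrableOn_comp_vertical hψ0 hψ1 hv _ _)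
    (((hI j ψ hψ0).add ((hI (Fin.last d) _ hψ1).const_mul _)).aestronglyMeasurable) ?_
    (integrableOn_lipschitz_bound hψ0 hψ1 L Lg) (Eventually.of_forall fun t => ?_)).2
  · rw [integral_add (hI j ψ hψ0) ((hI (Fin.last d) _ hψ1).const_mul _),
      integral_const_mul] at key
    exact key
  · filter_upwards [ae_restrict_mem measurableSet_Ioi] with t ht
    refine LipschitzOnWith.of_dist_le_mul fun h _ h' _ => ?_
    have ht0 : (0 : ℝ) ≤ t := (one_pos.trans ht).le
    rw [Real.dist_eq, ← sub_mul, abs_mul, Real.coe_nnabs,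
      abs_of_nonneg (a := L * (1 + t * Lg) * |ψ t|) (by positivity),
      mul_right_comm]
    gcongr
    refine (abs_vertical_sub_le hv hg ht0 _ _).trans (le_of_eq ?_)
    rw [dist_add_left, dist_eq_norm, dist_eq_norm, ← sub_smul, norm_smul, he,
      PiLp.norm_single, norm_one, mul_one]
  · have hline : HasDerivAt (fun h : ℝ => x + h • e) e 0 := by
      simpa using ((hasDerivAt_id (0 : ℝ)).smul_const e).const_add x
    have hx0 : x + (0 : ℝ) • e = x := by simp
    have hg' : HasDerivAt (fun h : ℝ => g (x + h • e)) (partialDeriv j g x) 0 := by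
      have := (hx0.symm ▸ hgx : DifferentiableAt ℝ g (x + (0 : ℝ) • e)).hasFDerivAt.comp_hasDerivAt
        (0 : ℝ) hline
      rw [hx0] at this
      exact this
    have hcurve : HasDerivAt (fun h : ℝ => (x + h • e) + EuclideanSpace.single (Fin.last d)
        (t * g (x + h • e))) (e + EuclideanSpace.single (Fin.last d) (t * partialDeriv j g x)) 0 := by
      have h1 := (hg'.const_mul t).smul_const (EuclideanSpace.single (Fin.last d) (1 : ℝ))
      simp only [single_last_eq_smul (t * _)]
      exact hline.add h1
    have h2 := (hvd.differentiable (by simp)).differentiableAt.hasFDerivAt.comp_hasDerivAt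
      (0 : ℝ) hcurve
    have h3 := h2.mul_const (ψ t)
    rw [partialDeriv_add_smul j (t * partialDeriv j g x) (by rw [he])] at h3
    refine h3.congr_deriv ?_
    simp only [hx0]
    ring

lemma volume_graph (hφ : Continuous φ) : volume ((above φ ∪ below φ)ᶜ) = 0 := by
  have hm : MeasurableSet ((above φ ∪ below φ)ᶜ) :=
    ((isOpen_above hφ).union (isOpen_below hφ)).measurableSet.compl
  rw [← lintegral_indicator_one hm, lintegral_eq_lintegral_glue
    (measurable_one.indicator hm)]
  have : ∀ y : Euc d, ∫⁻ s, (above φ ∪ below φ)ᶜ.indicator (1 : Euc (d + 1) → ℝ≥0∞) (glue y s) = 0 := by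
    intro y
    have e : (fun s => (above φ ∪ below φ)ᶜ.indicator (1 : Euc (d + 1) → ℝ≥0∞) (glue y s)) =
        ({φ y} : Set ℝ).indicator 1 := by
      ext s
      rcases lt_trichotomy (φ y) s with h | h | h
      · simp [indicator, above, below, h, h.le, h.ne']
      · simp [indicator, above, below, h]
      · simp [indicator, above, below, h, h.le, h.ne]
    rw [e, lintegral_indicator_one (measurableSet_singleton _), Real.volume_singleton]
  simp only [this, lintegral_zero]

lemma disjoint_above_below : Disjoint (above φ) (below φ) := by
  rw [Set.disjoint_left]
  intro x h1 h2
  exact lt_asymm (show φ (horiz x) < x (Fin.last d) from h1) h2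

lemma restrict_above_union_below (hφ : Continuous φ) :
    volume.restrict (above φ ∪ below φ) = (volume : Measure (Euc (d + 1))) := by
  rw [Measure.restrict_eq_self_of_ae_mem]
  exact volume_graph hφ

lemma integral_eq_above_add_below (hφ : Continuous φ) {f : Euc (d + 1) → ℝ} (hf : Integrable f) :
    ∫ x, f x = (∫ x in above φ, f x) + ∫ x in below φ, f x := by
  rw [← setIntegral_union disjoint_above_below (isOpen_below hφ).measurableSet hf.integrableOn
    hf.integrableOn, restrict_above_union_below hφ]

lemma lintegral_eq_above_add_below (hφ : Continuous φ) (f : Euc (d + 1) → ℝ≥0∞) :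
    ∫⁻ x, f x = (∫⁻ x in above φ, f x) + ∫⁻ x in below φ, f x := by
  rw [← lintegral_union (isOpen_below hφ).measurableSet disjoint_above_below,
    restrict_above_union_below hφ]

/-- Integration by parts for the extension of a smooth Lipschitz function `v`. The extension is
`vertInt g ψ v` on the whole space, because `ψ` has integral `1` and `g` vanishes off `below φ`;
hence it is Lipschitz and no boundary term arises. -/
lemma integral_extension_mul_partialDeriv (hφ : Continuous φ) (hψ0 : IntegrableOn ψ (Ioi 1))
    (hψ1 : IntegrableOn (fun t => t * ψ t) (Ioi 1)) (hψ : ∫ t in Ioi 1, ψ t = 1)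
    (hv : LipschitzWith L v) (hvd : ContDiff ℝ ∞ v) (hg : LipschitzWith Lg g)
    (hg0 : ∀ x ∉ below φ, g x = 0) (hgd : ∀ x ∈ below φ, DifferentiableAt ℝ g x)
    {η : Euc (d + 1) → ℝ} (hη : ContDiff ℝ ∞ η) (hηs : HasCompactSupport η) (j : Fin (d + 1)) :
    (∫ x in above φ, v x * partialDeriv j η x) +
        ∫ x in below φ, vertInt g ψ v x * partialDeriv j η x =
      -((∫ x in above φ, partialDeriv j v x * η x) +
        ∫ x in below φ, (vertInt g ψ (partialDeriv j v) x + partialDeriv j g x *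
          vertInt g (fun t => t * ψ t) (partialDeriv (Fin.last d) v) x) * η x) := by
  set w := vertInt g ψ v with hw
  obtain ⟨C, hC⟩ := exists_lipschitzWith_vertInt hψ0 hψ1 hv hg
  obtain ⟨D, hD⟩ := hη.lipschitzWith_of_hasCompactSupport hηs (by simp)
  have hwv : ∀ x ∉ below φ, w x = v x := by
    intro x hx
    have e0 : (EuclideanSpace.single (Fin.last d) (0 : ℝ) : Euc (d + 1)) = 0 := by
      ext i; simp
    simp only [hw, vertInt, hg0 x hx, mul_zero, e0, add_zero]
    rw [integral_const_mul, hψ, mul_one]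
  have habove : ∀ x ∈ above φ, x ∉ below φ := fun x hx hx' =>
    Set.disjoint_left.1 disjoint_above_below hx hx'
  have hmA := (isOpen_above hφ).measurableSet
  have hmB := (isOpen_below hφ).measurableSet
  have hηc : Continuous (partialDeriv j η) :=
    (hη.continuous_fderiv (by simp)).clm_apply continuous_const
  have hηcs : HasCompactSupport (partialDeriv j η) := hηs.fderiv_apply ℝ _
  have key := hC.integral_lineDeriv_mul_eq (μ := volume) hD hηs (EuclideanSpace.single j 1)
  have hneg : ∀ x, lineDeriv ℝ η x (-EuclideanSpace.single j 1) * w x =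
      -(w x * partialDeriv j η x) := by
    intro x
    rw [lineDeriv_neg, ((hη.differentiable (by simp)) x).lineDeriv_eq_fderiv, partialDeriv]
    ring
  simp only [← hw] at key
  simp only [hneg, integral_neg] at key
  have i1 : Integrable fun x => w x * partialDeriv j η x :=
    (hC.continuous.mul hηc).integrable_of_hasCompactSupport hηcs.mul_left
  have i2 : Integrable fun x => lineDeriv ℝ w x (EuclideanSpace.single j 1) * η x :=
    (hη.continuous.integrable_of_hasCompactSupport hηs).bdd_mul
      (aestronglyMeasurable_lineDeriv hC.continuous volume)
      (Eventually.of_forall fun x => norm_lineDeriv_le_of_lipschitz ℝ hC)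
  rw [integral_eq_above_add_below hφ i1, integral_eq_above_add_below hφ i2] at key
  have a1 : ∫ x in above φ, v x * partialDeriv j η x = ∫ x in above φ, w x * partialDeriv j η x :=
    setIntegral_congr_fun hmA fun x hx => by rw [hwv x (habove x hx)]
  have a2 : ∫ x in above φ, lineDeriv ℝ w x (EuclideanSpace.single j 1) * η x =
      ∫ x in above φ, partialDeriv j v x * η x := by
    refine setIntegral_congr_fun hmA fun x hx => ?_
    have : w =ᶠ[𝓝 x] v := by
      filter_upwards [(isOpen_above hφ).mem_nhds hx] with y hy using hwv y (habove y hy)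
    rw [this.lineDeriv_eq, ((hvd.differentiable (by simp)) x).lineDeriv_eq_fderiv, partialDeriv]
  have a3 : ∫ x in below φ, lineDeriv ℝ w x (EuclideanSpace.single j 1) * η x =
      ∫ x in below φ, (vertInt g ψ (partialDeriv j v) x + partialDeriv j g x *
          vertInt g (fun t => t * ψ t) (partialDeriv (Fin.last d) v) x) * η x := by
    refine setIntegral_congr_fun hmB fun x hx => ?_
    rw [(hasLineDerivAt_vertInt hψ0 hψ1 hv hvd hg (hgd x hx) j).lineDeriv]
  rw [a1, ← a3, ← a2, key, neg_neg]

end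

/-! ### One-sided mollifiers -/

section
variable {d : ℕ} {φ : Euc d → ℝ} {τ K : ℝ} {g : Euc (d + 1) → ℝ}

lemma norm_horiz_le (x : Euc (d + 1)) : ‖horiz x‖ ≤ ‖x‖ := by
  rw [EuclideanSpace.norm_eq, EuclideanSpace.norm_eq]
  refine Real.sqrt_le_sqrt ?_
  rw [Fin.sum_univ_castSucc]
  simp only [horiz]
  linarith [sq_nonneg ‖x (Fin.last d)‖]

/-- The radius `ε / (2 (1 + M))` keeps the ball around `-ε eₙ` inside the cone `yₙ < -M |y'|`, in
which subtraction of `y` moves no point across an `M`-Lipschitz graph. -/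
lemma sub_mem_above {M : ℝ} (hM : 0 < M) (hφ : ∀ x y, |φ x - φ y| ≤ M * ‖x - y‖) {ε : ℝ}
    (hε : 0 < ε) {x y : Euc (d + 1)} (hx : x ∈ above φ)
    (hy : ‖y - EuclideanSpace.single (Fin.last d) (-ε)‖ ≤ ε / (2 * (1 + M))) :
    x - y ∈ above φ := by
  set z := y - EuclideanSpace.single (Fin.last d) (-ε) with hz
  have hy' : y = z + EuclideanSpace.single (Fin.last d) (-ε) := by simp [hz]
  have hh : horiz (x - y) = horiz x - horiz z := by
    rw [hy']; ext i; simp [horiz]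
  have hl : (x - y) (Fin.last d) = x (Fin.last d) - z (Fin.last d) + ε := by
    rw [hy']; simp; ring
  have h1 := hφ (horiz x - horiz z) (horiz x)
  rw [sub_sub_cancel_left, norm_neg] at h1
  have h2 := norm_horiz_le z
  have h3 : |z (Fin.last d)| ≤ ‖z‖ := PiLp.norm_apply_le z _
  have h4 : (1 + M) * ‖z‖ ≤ ε / 2 := by
    calc (1 + M) * ‖z‖ ≤ (1 + M) * (ε / (2 * (1 + M))) := by gcongr
      _ = ε / 2 := by field_simp
  have h5 : M * ‖horiz z‖ ≤ M * ‖z‖ := by gcongr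
  have hx' : φ (horiz x) < x (Fin.last d) := hx
  show φ (horiz (x - y)) < (x - y) (Fin.last d)
  rw [hh, hl]
  have := (abs_le.1 h1).2
  have := (abs_le.1 h3).2
  linarith

/-- Mollifiers supported in small balls below the origin. The balls shrink to `0` and lie in the
cone of those `y` for which `x - y` stays above the graph whenever `x` does, so that mollification
at a point above the graph only uses values above the graph. -/
lemma exists_mollifiers {M : ℝ} (hM : 0 < M) (hφ : ∀ x y, |φ x - φ y| ≤ M * ‖x - y‖) :
    ∃ (ρ : ℕ → Euc (d + 1) → ℝ) (R : ℕ → ℝ), Tendsto R atTop (𝓝 0) ∧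
      (∀ k y, ρ k y ≠ 0 → ‖y‖ ≤ R k) ∧ ∀ k, ContDiff ℝ ∞ (ρ k) ∧ HasCompactSupport (ρ k) ∧
        (∀ y, 0 ≤ ρ k y) ∧ ∫ y, ρ k y = 1 ∧
          ∀ x ∈ above φ, ∀ y ∈ tsupport (ρ k), x - y ∈ above φ := by
  set ε : ℕ → ℝ := fun k => 1 / ((k : ℝ) + 1) with hεdef
  have hε : ∀ k, 0 < ε k := fun k => by positivity
  have hr : ∀ k, 0 < ε k / (2 * (1 + M)) := fun k => by have := hε k; positivity
  let b : ∀ k, ContDiffBump (EuclideanSpace.single (Fin.last d) (-ε k) : Euc (d + 1)) := fun k =>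
    ⟨ε k / (2 * (1 + M)) / 2, ε k / (2 * (1 + M)), half_pos (hr k), half_lt_self (hr k)⟩
  have hts : ∀ k, tsupport ((b k).normed volume) =
      Metric.closedBall (EuclideanSpace.single (Fin.last d) (-ε k)) (ε k / (2 * (1 + M))) :=
    fun k => (b k).tsupport_normed_eq
  refine ⟨fun k => (b k).normed volume, fun k => ε k / (2 * (1 + M)) + ε k, ?_, ?_, fun k =>
    ⟨(b k).contDiff_normed, (b k).hasCompactSupport_normed, fun y => (b k).nonneg_normed y,
      (b k).integral_normed, ?_⟩⟩
  · have h0 : Tendsto ε atTop (𝓝 0) := tendsto_one_div_add_atTop_nhds_zero_nat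
    simpa using (h0.div_const (2 * (1 + M))).add h0
  · intro k y hy
    have h1 : y ∈ tsupport ((b k).normed volume) := subset_tsupport _ hy
    rw [hts, Metric.mem_closedBall, dist_eq_norm] at h1
    have h2 := norm_le_norm_sub_add y (EuclideanSpace.single (Fin.last d) (-ε k))
    rw [PiLp.norm_single, norm_neg, Real.norm_of_nonneg (hε k).le] at h2
    linarith
  · intro x hx y hy
    rw [hts, Metric.mem_closedBall, dist_eq_norm] at hy
    exact sub_mem_above hM hφ (hε k) hx hy

/-! ### The weak gradient of the extension -/

/-- The function equal to `a` above and to `b` below the graph of `φ`. -/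
def patch (φ : Euc d → ℝ) (a b : Euc (d + 1) → ℝ) (x : Euc (d + 1)) : ℝ :=
  (above φ).indicator a x + (below φ).indicator b x

lemma patch_above {a b : Euc (d + 1) → ℝ} {x : Euc (d + 1)} (hx : x ∈ above φ) :
    patch φ a b x = a x := by
  have : x ∉ below φ := Set.disjoint_left.1 disjoint_above_below hx
  simp [patch, hx, this]

lemma patch_below {a b : Euc (d + 1) → ℝ} {x : Euc (d + 1)} (hx : x ∈ below φ) :
    patch φ a b x = b x := by
  have : x ∉ above φ := Set.disjoint_right.1 disjoint_above_below hx
  simp [patch, hx, this]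

lemma memLp_patch (hφ : Continuous φ) {a b : Euc (d + 1) → ℝ} {q : ℝ≥0∞}
    (ha : MemLp a q (volume.restrict (above φ))) (hb : MemLp b q (volume.restrict (below φ))) :
    MemLp (patch φ a b) q volume :=
  ((memLp_indicator_iff_restrict (isOpen_above hφ).measurableSet).2 ha).add
    ((memLp_indicator_iff_restrict (isOpen_below hφ).measurableSet).2 hb)

lemma lintegral_patch (hφ : Continuous φ) (a b : Euc (d + 1) → ℝ) (p : ℝ) :
    ∫⁻ x, ‖patch φ a b x‖ₑ ^ p =
      (∫⁻ x in above φ, ‖a x‖ₑ ^ p) + ∫⁻ x in below φ, ‖b x‖ₑ ^ p := by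
  rw [lintegral_eq_above_add_below hφ]
  congr 1
  · exact setLIntegral_congr_fun (isOpen_above hφ).measurableSet fun x hx => by
      rw [patch_above hx]
  · exact setLIntegral_congr_fun (isOpen_below hφ).measurableSet fun x hx => by
      rw [patch_below hx]

lemma integral_patch_mul (hφ : Continuous φ) {a b η : Euc (d + 1) → ℝ}
    (h : Integrable fun x => patch φ a b x * η x) :
    ∫ x, patch φ a b x * η x = (∫ x in above φ, a x * η x) + ∫ x in below φ, b x * η x := by
  rw [integral_eq_above_add_below hφ h]
  congr 1
  · exact setIntegral_congr_fun (isOpen_above hφ).measurableSet fun x hx => by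
      rw [patch_above hx]
  · exact setIntegral_congr_fun (isOpen_below hφ).measurableSet fun x hx => by
      rw [patch_below hx]

lemma IsScale.vertInt_congr (h : IsScale φ τ K g) (hτ : 0 < τ) (κ : ℝ → ℝ)
    {f₁ f₂ : Euc (d + 1) → ℝ} (hf : ∀ y ∈ above φ, f₁ y = f₂ y) {x : Euc (d + 1)}
    (hx : x ∈ below φ) : vertInt g κ f₁ x = vertInt g κ f₂ x :=
  setIntegral_congr_fun measurableSet_Ioi fun t ht => by
    rw [hf _ (h.add_single_mem hτ hx (le_of_lt ht))]

lemma memLp_bdd_mul {q : ℝ≥0∞} {b f : Euc (d + 1) → ℝ} {Bd : ℝ} (hφ : Continuous φ)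
    (hbm : Measurable b) (hbb : ∀ x ∈ below φ, |b x| ≤ Bd)
    (hf : MemLp f q (volume.restrict (below φ))) :
    MemLp (fun x => b x * f x) q (volume.restrict (below φ)) := by
  refine hf.of_le_mul (c := Bd) (hbm.aestronglyMeasurable.mul hf.1) ?_
  filter_upwards [ae_restrict_mem (isOpen_below hφ).measurableSet] with x hx
  rw [norm_mul]
  gcongr
  exact hbb x hx

/-- The kernel operators are continuous in `L^r`, hence so are their integrals against test
functions. -/
lemma IsScale.tendsto_integral_vertInt (h : IsScale φ τ K g) (hφ : Continuous φ) (hτ : 0 < τ)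
    (hK : 0 < K) (hg : Measurable g) {κ : ℝ → ℝ} {C : ℝ} (hκ : ∀ t, 1 ≤ t → |κ t| ≤ C / t ^ 2)
    (hκm : AEStronglyMeasurable κ (volume.restrict (Ioi 1))) {r : ℝ} (hr : 1 ≤ r)
    {b : Euc (d + 1) → ℝ} {Bd : ℝ} (hbm : Measurable b) (hbb : ∀ x ∈ below φ, |b x| ≤ Bd)
    {F : ℕ → Euc (d + 1) → ℝ} {f : Euc (d + 1) → ℝ}
    (hF : ∀ k, MemLp (F k) (ENNReal.ofReal r) (volume.restrict (above φ)))
    (hf : MemLp f (ENNReal.ofReal r) (volume.restrict (above φ)))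
    (hFf : Tendsto (fun k => eLpNorm (F k - f) (ENNReal.ofReal r) (volume.restrict (above φ)))
      atTop (𝓝 0)) {η : Euc (d + 1) → ℝ} (hη : Continuous η) (hηs : HasCompactSupport η) :
    Tendsto (fun k => ∫ x in below φ, b x * vertInt g κ (F k) x * η x) atTop
      (𝓝 (∫ x in below φ, b x * vertInt g κ f x * η x)) := by
  have hm := fun {f} => memLp_bdd_mul (q := ENNReal.ofReal r) (f := f) hφ hbm hbb
  have hv := fun {f} => h.memLp_vertInt (f := f) hφ hτ hK hg hκ hκm hr
  refine tendsto_integral_mul_of_eLpNorm hr hη hηs (fun k => hm (hv (hF k))) (hm (hv hf)) ?_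
  set c := ENNReal.ofReal (C * (K * r / ((r + 1) * τ ^ (1 + 1 / r))))
  have hlim : Tendsto (fun k => ENNReal.ofReal Bd * (c * eLpNorm (F k - f) (ENNReal.ofReal r)
      (volume.restrict (above φ)))) atTop (𝓝 0) := by
    have := ENNReal.Tendsto.const_mul (a := ENNReal.ofReal Bd)
      (ENNReal.Tendsto.const_mul (a := c) hFf (Or.inr ENNReal.ofReal_ne_top))
      (Or.inr ENNReal.ofReal_ne_top)
    simpa using this
  refine tendsto_of_tendsto_of_tendsto_of_le_of_le tendsto_const_nhds hlim (fun _ => zero_le)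
    fun k => ?_
  refine le_trans (eLpNorm_le_mul_eLpNorm_of_ae_le_mul (c := Bd) (g := vertInt g κ (F k - f)) ?_ _)
    (mul_le_mul_right (h.eLpNorm_vertInt_le hφ hτ hK hg hκ hr ((hF k).sub hf).1) _)
  filter_upwards [h.vertInt_sub hφ hτ hK hg hκ hκm hr (hF k) hf,
    ae_restrict_mem (isOpen_below hφ).measurableSet] with x hx hxb
  rw [hx, Pi.sub_apply, Pi.sub_apply, ← mul_sub, norm_mul]
  gcongr
  exact hbb x hxb

/-- The weak gradient of the extension below the graph. -/
def extGrad (g : Euc (d + 1) → ℝ) (ψ : ℝ → ℝ) (G : Fin (d + 1) → Euc (d + 1) → ℝ)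
    (j : Fin (d + 1)) (x : Euc (d + 1)) : ℝ :=
  vertInt g ψ (G j) x + partialDeriv j g x * vertInt g (fun t => t * ψ t) (G (Fin.last d)) x

/-- The chain rule for the extension of a Sobolev function, from the smooth case by
mollification. -/
lemma IsScale.integral_patch_mul_partialDeriv (h : IsScale φ τ K g) {M : ℝ} (hM : 0 < M)
    (hφL : ∀ x y, |φ x - φ y| ≤ M * ‖x - y‖) (hφ : Continuous φ) (hτ : 0 < τ) (hK : 0 < K)
    {Lg : ℝ≥0} (hg : LipschitzWith Lg g) (hg0 : ∀ x ∉ below φ, g x = 0)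
    (hgd : ∀ x ∈ below φ, DifferentiableAt ℝ g x) {Bd : ℝ}
    (hgb : ∀ j, ∀ x ∈ below φ, |partialDeriv j g x| ≤ Bd)
    {ψ : ℝ → ℝ} (hψ0 : IntegrableOn ψ (Ioi 1))
    (hψ1 : IntegrableOn (fun t => t * ψ t) (Ioi 1)) (hψ : ∫ t in Ioi 1, ψ t = 1)
    {C₀ C₁ : ℝ} (hC₀ : ∀ t, 1 ≤ t → |ψ t| ≤ C₀ / t ^ 2)
    (hC₁ : ∀ t, 1 ≤ t → |t * ψ t| ≤ C₁ / t ^ 2) {r : ℝ} (hr : 1 ≤ r)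
    {u : Euc (d + 1) → ℝ} {G : Fin (d + 1) → Euc (d + 1) → ℝ}
    (hu : MemLp u (ENNReal.ofReal r) (volume.restrict (above φ)))
    (hG : ∀ j, MemLp (G j) (ENNReal.ofReal r) (volume.restrict (above φ)))
    (hw : IsWeakGrad (above φ) u G) {η : Euc (d + 1) → ℝ} (hη : ContDiff ℝ ∞ η)
    (hηs : HasCompactSupport η) (j : Fin (d + 1)) :
    (∫ x in above φ, u x * partialDeriv j η x) +
        ∫ x in below φ, vertInt g ψ u x * partialDeriv j η x =
      -((∫ x in above φ, G j x * η x) + ∫ x in below φ, extGrad g ψ G j x * η x) := by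
  have hr1 : 1 ≤ ENNReal.ofReal r := by simpa using ENNReal.ofReal_le_ofReal hr
  have hmA := (isOpen_above hφ).measurableSet
  have hmB := (isOpen_below hφ).measurableSet
  have hgm : Measurable g := hg.continuous.measurable
  have hηc : Continuous (partialDeriv j η) :=
    (hη.continuous_fderiv (by simp)).clm_apply continuous_const
  have hηcs : HasCompactSupport (partialDeriv j η) := hηs.fderiv_apply ℝ _
  obtain ⟨ρ, R, hR, hρR, hρ⟩ := exists_mollifiers hM hφL
  choose hρd hρs hρ0 hρ1 hρA using hρ
  -- the mollified zero extension converges in `L^r` above the graph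
  have hind : ∀ {f : Euc (d + 1) → ℝ}, MemLp f (ENNReal.ofReal r) (volume.restrict (above φ)) →
      MemLp ((above φ).indicator f) (ENNReal.ofReal r) volume := fun hf =>
    (memLp_indicator_iff_restrict hmA).2 hf
  have hmem : ∀ {f : Euc (d + 1) → ℝ}, MemLp f (ENNReal.ofReal r) (volume.restrict (above φ)) →
      ∀ k, MemLp (mollify (ρ k) ((above φ).indicator f)) (ENNReal.ofReal r)
        (volume.restrict (above φ)) := fun hf k =>
    (memLp_mollify (hρd k) (hρs k) (hρ0 k) (hρ1 k) hr (hind hf)).restrict _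
  have hconv : ∀ {f : Euc (d + 1) → ℝ}, MemLp f (ENNReal.ofReal r) (volume.restrict (above φ)) →
      Tendsto (fun k => eLpNorm (mollify (ρ k) ((above φ).indicator f) - f) (ENNReal.ofReal r)
        (volume.restrict (above φ))) atTop (𝓝 0) := by
    intro f hf
    refine tendsto_of_tendsto_of_tendsto_of_le_of_le tendsto_const_nhds
      (tendsto_eLpNorm_mollify_sub (fun k => (hρd k).continuous) hρs hρ0 hρ1 hR hρR hr (hind hf))
      (fun _ => zero_le) fun k => ?_
    refine le_trans (le_of_eq (eLpNorm_congr_ae ?_)) (eLpNorm_restrict_le _ _ _ (above φ))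
    filter_upwards [ae_restrict_mem hmA] with x hx
    simp [hx]
  have hone : ∀ x ∈ below φ, |(fun _ => (1 : ℝ)) x| ≤ 1 := fun x _ => by simp
  have hpm : Measurable (partialDeriv j g) := measurable_fderiv_apply_const ℝ g _
  have l1 := tendsto_integral_mul_of_eLpNorm hr hηc hηcs (hmem hu) hu (hconv hu)
  have l2 := h.tendsto_integral_vertInt hφ hτ hK hgm hC₀ hψ0.aestronglyMeasurable hr
    measurable_const hone (hmem hu) hu (hconv hu) hηc hηcs
  have l3 := tendsto_integral_mul_of_eLpNorm hr hη.continuous hηs (hmem (hG j)) (hG j)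
    (hconv (hG j))
  have l4 := h.tendsto_integral_vertInt hφ hτ hK hgm hC₀ hψ0.aestronglyMeasurable hr
    measurable_const hone (hmem (hG j)) (hG j) (hconv (hG j)) hη.continuous hηs
  have l5 := h.tendsto_integral_vertInt hφ hτ hK hgm hC₁ hψ1.aestronglyMeasurable hr
    hpm (hgb j) (hmem (hG (Fin.last d))) (hG (Fin.last d)) (hconv (hG (Fin.last d)))
    hη.continuous hηs
  simp only [one_mul] at l2 l4
  have hsplit : ∀ {f₁ f₂ : Euc (d + 1) → ℝ},
      MemLp f₁ (ENNReal.ofReal r) (volume.restrict (above φ)) →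
      MemLp f₂ (ENNReal.ofReal r) (volume.restrict (above φ)) →
      ∫ x in below φ, (vertInt g ψ f₁ x + partialDeriv j g x *
        vertInt g (fun t => t * ψ t) f₂ x) * η x =
      (∫ x in below φ, vertInt g ψ f₁ x * η x) +
        ∫ x in below φ, partialDeriv j g x * vertInt g (fun t => t * ψ t) f₂ x * η x := by
    intro f₁ f₂ h1 h2
    simp only [add_mul]
    exact integral_add (integrable_mul_of_memLp hr hη.continuous hηs
        (h.memLp_vertInt hφ hτ hK hgm hC₀ hψ0.aestronglyMeasurable hr h1))
      (integrable_mul_of_memLp hr hη.continuous hηs (memLp_bdd_mul hφ hpm (hgb j)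
        (h.memLp_vertInt hφ hτ hK hgm hC₁ hψ1.aestronglyMeasurable hr h2)))
  have hid : ∀ k, (∫ x in above φ, mollify (ρ k) ((above φ).indicator u) x * partialDeriv j η x) +
        ∫ x in below φ, vertInt g ψ (mollify (ρ k) ((above φ).indicator u)) x *
          partialDeriv j η x =
      -((∫ x in above φ, mollify (ρ k) ((above φ).indicator (G j)) x * η x) +
        ((∫ x in below φ, vertInt g ψ (mollify (ρ k) ((above φ).indicator (G j))) x * η x) +
        ∫ x in below φ, partialDeriv j g x * vertInt g (fun t => t * ψ t)
          (mollify (ρ k) ((above φ).indicator (G (Fin.last d)))) x * η x)) := by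
    intro k
    obtain ⟨L, hL⟩ := exists_lipschitzWith_mollify (hρd k) (hρs k) hr (hind hu)
    have hli := (hind hu).locallyIntegrable hr1
    have hpd : ∀ i, ∀ y ∈ above φ, partialDeriv i (mollify (ρ k) ((above φ).indicator u)) y =
        mollify (ρ k) ((above φ).indicator (G i)) y := fun i y hy =>
      hw.partialDeriv_mollify hmA (hρd k) (hρs k) hli (hρA k y hy) i
    rw [integral_extension_mul_partialDeriv hφ hψ0 hψ1 hψ hL
      (contDiff_mollify (hρd k) (hρs k) hli) hg hg0 hgd hη hηs j,
      ← hsplit (hmem (hG j) k) (hmem (hG (Fin.last d)) k)]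
    congr 2
    · exact setIntegral_congr_fun hmA fun x hx => by rw [hpd j x hx]
    · exact setIntegral_congr_fun hmB fun x hx => by
        rw [h.vertInt_congr hτ ψ (hpd j) hx, h.vertInt_congr hτ _ (hpd (Fin.last d)) hx]
  have hL := l1.add l2
  simp only [hid] at hL
  have hR := (l3.add (l4.add l5)).neg
  rw [tendsto_nhds_unique hL hR, ← hsplit (hG j) (hG (Fin.last d))]
  rfl

lemma IsScale.memLp_extGrad (h : IsScale φ τ K g) (hφ : Continuous φ) (hτ : 0 < τ) (hK : 0 < K)
    (hg : Measurable g) {Bd : ℝ}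
    (hgb : ∀ j, ∀ x ∈ below φ, |partialDeriv j g x| ≤ Bd)
    {ψ : ℝ → ℝ} (hψ0 : IntegrableOn ψ (Ioi 1))
    (hψ1 : IntegrableOn (fun t => t * ψ t) (Ioi 1))
    {C₀ C₁ : ℝ} (hC₀ : ∀ t, 1 ≤ t → |ψ t| ≤ C₀ / t ^ 2)
    (hC₁ : ∀ t, 1 ≤ t → |t * ψ t| ≤ C₁ / t ^ 2) {r : ℝ} (hr : 1 ≤ r)
    {G : Fin (d + 1) → Euc (d + 1) → ℝ}
    (hG : ∀ j, MemLp (G j) (ENNReal.ofReal r) (volume.restrict (above φ))) (j : Fin (d + 1)) :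
    MemLp (extGrad g ψ G j) (ENNReal.ofReal r) (volume.restrict (below φ)) :=
  (h.memLp_vertInt hφ hτ hK hg hC₀ hψ0.aestronglyMeasurable hr (hG j)).add
    (memLp_bdd_mul hφ (measurable_fderiv_apply_const ℝ g _) (hgb j)
      (h.memLp_vertInt hφ hτ hK hg hC₁ hψ1.aestronglyMeasurable hr (hG (Fin.last d))))

end

/-! ### Distance to the graph -/

lemma norm_sq_eq_horiz {d : ℕ} (x : Euc (d + 1)) :
    ‖x‖ ^ 2 = ‖horiz x‖ ^ 2 + x (Fin.last d) ^ 2 := by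
  rw [EuclideanSpace.norm_sq_eq, EuclideanSpace.norm_sq_eq, Fin.sum_univ_castSucc]
  simp [horiz]

section
variable {d : ℕ} {φ : Euc d → ℝ} {M : ℝ}

lemma continuous_of_abs_sub_le (hφ : ∀ x y, |φ x - φ y| ≤ M * ‖x - y‖) :
    Continuous φ := by
  refine LipschitzWith.continuous (K := M.toNNReal) (LipschitzWith.of_dist_le_mul fun x y => ?_)
  rw [Real.dist_eq, dist_eq_norm]
  refine (hφ x y).trans ?_
  gcongr
  exact Real.le_coe_toNNReal M

lemma closure_above (hφ : Continuous φ) : closure (above φ) = (below φ)ᶜ := by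
  refine Subset.antisymm (closure_minimal ?_ (isOpen_below hφ).isClosed_compl) fun x hx => ?_
  · exact fun x hx => Set.disjoint_left.1 disjoint_above_below hx
  · have hx' : φ (horiz x) ≤ x (Fin.last d) := not_lt.1 hx
    have hcont : Continuous fun c : ℝ => x + EuclideanSpace.single (Fin.last d) c :=
      continuous_const.add continuous_single_last
    have ht : Tendsto (fun c : ℝ => x + EuclideanSpace.single (Fin.last d) c) (𝓝[>] 0) (𝓝 x) := by
      have h0 : x + EuclideanSpace.single (Fin.last d) (0 : ℝ) = x := by ext i; simp
      have := hcont.tendsto 0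
      rw [h0] at this
      exact this.mono_left nhdsWithin_le_nhds
    refine mem_closure_of_tendsto ht ?_
    filter_upwards [self_mem_nhdsWithin] with c hc
    have hc' : (0 : ℝ) < c := hc
    have : φ (horiz x) < x (Fin.last d) + c := by linarith
    simpa [above] using this

/-- The vertical depth is comparable to the distance to the region above the graph: the graph
makes an angle at most `arctan M` with the horizontal. -/
lemma depth_le_infDist (hφ : ∀ x y, |φ x - φ y| ≤ M * ‖x - y‖) (x : Euc (d + 1)) :
    φ (horiz x) - x (Fin.last d) ≤ √(1 + M ^ 2) * Metric.infDist x (below φ)ᶜ := by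
  have hne : ((below φ)ᶜ : Set (Euc (d + 1))).Nonempty :=
    ⟨glue 0 (φ 0), by simp [below]⟩
  have hs : 0 < √(1 + M ^ 2) := by positivity
  rw [← div_le_iff₀' hs, Metric.le_infDist hne]
  intro y hy
  have hy' : φ (horiz y) ≤ y (Fin.last d) := not_lt.1 hy
  rw [div_le_iff₀' hs, dist_comm, dist_eq_norm]
  have h1 := (abs_le.1 (hφ (horiz y) (horiz x))).1
  have hh : horiz (y - x) = horiz y - horiz x := by ext i; simp [horiz]
  have h2 := norm_sq_eq_horiz (y - x)
  rw [hh, PiLp.sub_apply] at h2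
  set a := ‖horiz y - horiz x‖
  set b := y (Fin.last d) - x (Fin.last d)
  have h3 : φ (horiz x) - x (Fin.last d) ≤ b + M * a := by simp only [b]; linarith
  refine h3.trans (le_trans ?_ (le_of_eq (by
    rw [← Real.sqrt_sq (norm_nonneg (y - x)), ← Real.sqrt_mul (by positivity), h2])))
  refine Real.le_sqrt_of_sq_le ?_
  nlinarith [sq_nonneg (a - M * b)]

lemma infDist_le_depth {x : Euc (d + 1)} (hx : x ∈ below φ) :
    Metric.infDist x (below φ)ᶜ ≤ φ (horiz x) - x (Fin.last d) := by
  have hx' : x (Fin.last d) < φ (horiz x) := hx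
  have hmem : x + EuclideanSpace.single (Fin.last d) (φ (horiz x) - x (Fin.last d)) ∈
      (below φ)ᶜ := by simp [below]
  refine (Metric.infDist_le_dist_of_mem hmem).trans (le_of_eq ?_)
  rw [dist_self_add_right, PiLp.norm_single, Real.norm_of_nonneg (by linarith)]

end

/-! ### Gradients and partial derivatives -/

lemma foldr_partialDeriv_single {n : ℕ} (j : Fin n) (f : Euc n → ℝ) (l : List (Fin n))
    (hl : l.Nodup) :
    l.foldr (fun i g => (partialDeriv i)^[(Pi.single j 1 : Fin n → ℕ) i] g) f =
      if j ∈ l then partialDeriv j f else f := by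
  induction l with
  | nil => simp
  | cons a l ih =>
    rw [List.nodup_cons] at hl
    rw [List.foldr_cons, ih hl.2]
    by_cases h : j = a
    · subst h; simp [hl.1]
    · simp [h]

lemma multiDeriv_single {n : ℕ} (j : Fin n) (f : Euc n → ℝ) :
    multiDeriv (Pi.single j 1) f = partialDeriv j f := by
  rw [multiDeriv, foldr_partialDeriv_single j f _ (List.nodup_finRange n)]
  simp

lemma norm_fderiv_le_of_partialDeriv {n : ℕ} {f : Euc n → ℝ} {x : Euc n} {B : ℝ}
    (hB : 0 ≤ B) (h : ∀ j, |partialDeriv j f x| ≤ B) : ‖fderiv ℝ f x‖ ≤ n * B := by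
  refine ContinuousLinearMap.opNorm_le_bound _ (by positivity) fun z => ?_
  have hz : z = ∑ j, z j • EuclideanSpace.single j (1 : ℝ) := by
    ext i
    simp [Finset.sum_apply, Pi.single_apply]
  calc ‖fderiv ℝ f x z‖ = ‖∑ j, z j * partialDeriv j f x‖ := by
        nth_rw 1 [hz]
        simp [map_sum, partialDeriv]
    _ ≤ ∑ _j : Fin n, ‖z‖ * B := by
        refine norm_sum_le_of_le _ fun j _ => ?_
        rw [norm_mul]
        exact mul_le_mul (PiLp.norm_apply_le z j) (h j) (abs_nonneg _) (norm_nonneg _)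
    _ = n * B * ‖z‖ := by simp; ring

/-- Weak gradients are unique up to null sets. -/
lemma IsWeakGrad.ae_eq {n : ℕ} {Ω : Set (Euc n)} (hΩ : IsOpen Ω) {u : Euc n → ℝ}
    {G G' : Fin n → Euc n → ℝ} (h : IsWeakGrad Ω u G) (h' : IsWeakGrad Ω u G') (j : Fin n) :
    G j =ᵐ[volume.restrict Ω] G' j := by
  have hint : ∀ {f η : Euc n → ℝ}, LocallyIntegrableOn f Ω → ContDiff ℝ ∞ η →
      HasCompactSupport η → tsupport η ⊆ Ω → IntegrableOn (fun x => f x * η x) Ω := by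
    intro f η hf hη hηs hηΩ
    have hK : IntegrableOn f (tsupport η) := hf.integrableOn_compact_subset hηΩ hηs
    have h1 : IntegrableOn (fun x => f x * η x) (tsupport η) :=
      hK.mul_continuousOn hη.continuous.continuousOn hηs
    refine Integrable.integrableOn ((integrableOn_iff_integrable_of_support_subset ?_).1 h1)
    intro x hx
    exact subset_tsupport _ (right_ne_zero_of_mul hx)
  have hz := hΩ.ae_eq_zero_of_integral_contDiff_smul_eq_zero (μ := volume)
    (f := fun x => G j x - G' j x) ((h.2 j).1.sub (h'.2 j).1) (fun η hη hηs hηΩ => by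
      rw [← setIntegral_eq_integral_of_forall_compl_eq_zero (s := Ω)]
      · have e1 := (h.2 j).2 η hη hηs hηΩ
        have e2 := (h'.2 j).2 η hη hηs hηΩ
        have e3 : ∀ x, η x • (G j x - G' j x) = G j x * η x - G' j x * η x := fun x => by
          rw [smul_eq_mul]; ring
        simp only [e3]
        rw [integral_sub (hint (h.2 j).1 hη hηs hηΩ) (hint (h'.2 j).1 hη hηs hηΩ)]
        linarith
      · intro x hx
        have : η x = 0 := image_eq_zero_of_notMem_tsupport fun hx' => hx (hηΩ hx')
        simp [this])
  filter_upwards [ae_restrict_of_ae hz, ae_restrict_mem hΩ.measurableSet] with x hx hxΩ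
  exact sub_eq_zero.1 (hx hxΩ)

lemma gradLpNorm_congr {n : ℕ} {Ω : Set (Euc n)} (p : ℝ) {G G' : Fin n → Euc n → ℝ}
    (h : ∀ j, G j =ᵐ[volume.restrict Ω] G' j) : gradLpNorm Ω p G = gradLpNorm Ω p G' := by
  unfold gradLpNorm
  congr 1
  refine Finset.sum_congr rfl fun j _ => lintegral_congr_ae ?_
  filter_upwards [h j] with x hx
  rw [hx]

/-! ### The gradient bound -/

section
variable {d : ℕ} {φ : Euc d → ℝ} {τ K : ℝ} {g : Euc (d + 1) → ℝ} {ψ : ℝ → ℝ} {C₀ C₁ Bd : ℝ}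
  {G : Fin (d + 1) → Euc (d + 1) → ℝ} {p : ℝ}

lemma nonneg_of_kernel_le {κ : ℝ → ℝ} {C : ℝ} (hκ : ∀ t, 1 ≤ t → |κ t| ≤ C / t ^ 2) : 0 ≤ C := by
  simpa using (abs_nonneg _).trans (hκ 1 le_rfl)

/-- In the vertical direction both terms of the chain rule involve the same derivative, so they
are estimated together. -/
lemma IsScale.lintegral_extGrad_last_le (h : IsScale φ τ K g) (hφ : Continuous φ) (hτ : 0 < τ)
    (hK : 0 < K) (hg : Measurable g) (hBd : 0 ≤ Bd)
    (hgb : ∀ j, ∀ x ∈ below φ, |partialDeriv j g x| ≤ Bd)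
    (hC₀ : ∀ t, 1 ≤ t → |ψ t| ≤ C₀ / t ^ 2)
    (hC₁ : ∀ t, 1 ≤ t → |t * ψ t| ≤ C₁ / t ^ 2) (hp : 1 ≤ p)
    (hG : ∀ j, AEStronglyMeasurable (G j) (volume.restrict (above φ))) :
    ∫⁻ x in below φ, ‖extGrad g ψ G (Fin.last d) x‖ₑ ^ p ≤
      ENNReal.ofReal ((C₀ + Bd * C₁) * (K * p / ((p + 1) * τ ^ (1 + 1 / p)))) ^ p *
        ∫⁻ x in above φ, ‖G (Fin.last d) x‖ₑ ^ p := by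
  have hp0 : 0 < p := by linarith
  have h0 := nonneg_of_kernel_le hC₀
  have h1 := nonneg_of_kernel_le hC₁
  calc _ ≤ ∫⁻ x in below φ, ENNReal.ofReal (C₀ + Bd * C₁) ^ p *
        vertAvg g (fun y => ‖G (Fin.last d) y‖ₑ) x ^ p := by
        refine setLIntegral_mono' (isOpen_below hφ).measurableSet fun x hx => ?_
        rw [← ENNReal.mul_rpow_of_nonneg _ _ hp0.le]
        gcongr
        rw [extGrad, ENNReal.ofReal_add h0 (by positivity), ENNReal.ofReal_mul hBd, add_mul,
          mul_assoc]
        refine (enorm_add_le _ _).trans ?_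
        rw [enorm_mul]
        gcongr
        · exact enorm_vertInt_le hC₀ _ x
        · rw [Real.enorm_eq_ofReal_abs]
          exact ENNReal.ofReal_le_ofReal (hgb _ x hx)
        · exact enorm_vertInt_le hC₁ _ x
    _ ≤ _ := by
        rw [lintegral_const_mul' _ _ (ENNReal.rpow_ne_top_of_nonneg hp0.le ENNReal.ofReal_ne_top),
          ENNReal.ofReal_mul (by positivity), ENNReal.mul_rpow_of_nonneg _ _ hp0.le, mul_assoc]
        gcongr
        exact h.lintegral_vertAvg_le' hφ hτ hK hg hp (hG _).enorm

lemma IsScale.lintegral_extGrad_le (h : IsScale φ τ K g) (hφ : Continuous φ) (hτ : 0 < τ)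
    (hK : 0 < K) (hg : Measurable g) (hBd : 0 ≤ Bd)
    (hgb : ∀ j, ∀ x ∈ below φ, |partialDeriv j g x| ≤ Bd)
    (hψm : AEStronglyMeasurable ψ (volume.restrict (Ioi 1)))
    (hC₀ : ∀ t, 1 ≤ t → |ψ t| ≤ C₀ / t ^ 2)
    (hC₁ : ∀ t, 1 ≤ t → |t * ψ t| ≤ C₁ / t ^ 2) (hp : 1 ≤ p)
    (hG : ∀ j, AEStronglyMeasurable (G j) (volume.restrict (above φ))) (j : Fin (d + 1)) :
    ∫⁻ x in below φ, ‖extGrad g ψ G j x‖ₑ ^ p ≤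
      2 ^ (p - 1) * (ENNReal.ofReal (C₀ * (K * p / ((p + 1) * τ ^ (1 + 1 / p)))) ^ p *
          (∫⁻ x in above φ, ‖G j x‖ₑ ^ p) +
        ENNReal.ofReal (Bd * C₁ * (K * p / ((p + 1) * τ ^ (1 + 1 / p)))) ^ p *
          ∫⁻ x in above φ, ‖G (Fin.last d) x‖ₑ ^ p) := by
  have hp0 : 0 < p := by linarith
  have h2 : (2 : ℝ≥0∞) ^ (p - 1) ≠ ⊤ :=
    ENNReal.rpow_ne_top_of_nonneg (by linarith) (by simp)
  have hBt : ENNReal.ofReal Bd ^ p ≠ ⊤ :=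
    ENNReal.rpow_ne_top_of_nonneg hp0.le ENNReal.ofReal_ne_top
  calc _ ≤ ∫⁻ x in below φ, 2 ^ (p - 1) * (‖vertInt g ψ (G j) x‖ₑ ^ p + ENNReal.ofReal Bd ^ p *
        ‖vertInt g (fun t => t * ψ t) (G (Fin.last d)) x‖ₑ ^ p) := by
        refine setLIntegral_mono' (isOpen_below hφ).measurableSet fun x hx => ?_
        rw [← ENNReal.mul_rpow_of_nonneg (ENNReal.ofReal Bd) _ hp0.le]
        refine le_trans ?_ (ENNReal.rpow_add_le_mul_rpow_add_rpow _ _ hp)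
        gcongr
        refine (enorm_add_le _ _).trans ?_
        rw [enorm_mul]
        gcongr
        rw [Real.enorm_eq_ofReal_abs]
        exact ENNReal.ofReal_le_ofReal (hgb _ x hx)
    _ = 2 ^ (p - 1) * ((∫⁻ x in below φ, ‖vertInt g ψ (G j) x‖ₑ ^ p) + ENNReal.ofReal Bd ^ p *
        ∫⁻ x in below φ, ‖vertInt g (fun t => t * ψ t) (G (Fin.last d)) x‖ₑ ^ p) := by
        rw [lintegral_const_mul' _ _ h2, lintegral_add_left'
          ((h.aestronglyMeasurable_vertInt hφ hτ hK hg hψm (hG j)).enorm.pow_const p),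
          lintegral_const_mul' _ _ hBt]
    _ ≤ _ := by
        rw [mul_assoc Bd, ENNReal.ofReal_mul hBd, ENNReal.mul_rpow_of_nonneg _ _ hp0.le,
          mul_assoc (ENNReal.ofReal Bd ^ p)]
        gcongr
        · exact lintegral_vertInt_le h hφ hτ hK hg hC₀ hp (hG j)
        · exact lintegral_vertInt_le h hφ hτ hK hg hC₁ hp (hG _)

end

/-- The elementary summation behind the gradient bound: the first `d` directions share the
coefficient `a`, while the last one collects the contributions of all of them. -/
lemma sum_gradient_bound {d : ℕ} {α β γ s : ℝ≥0∞} (a e : Fin (d + 1) → ℝ≥0∞)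
    (hlast : e (Fin.last d) ≤ γ * a (Fin.last d))
    (h : ∀ j, e j ≤ s * (α * a j + β * a (Fin.last d))) {c : ℝ≥0∞}
    (h1 : s * α + 1 ≤ c) (h2 : d * (s * β) + γ + 1 ≤ c) :
    ∑ j, (a j + e j) ≤ c * ∑ j, a j := by
  rw [Fin.sum_univ_castSucc, Fin.sum_univ_castSucc a]
  calc _ ≤ ∑ i : Fin d, (a i.castSucc + s * (α * a i.castSucc + β * a (Fin.last d))) +
        (a (Fin.last d) + γ * a (Fin.last d)) := by
        gcongr with i
        exact h _
    _ = (s * α + 1) * ∑ i : Fin d, a i.castSucc +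
        (d * (s * β) + γ + 1) * a (Fin.last d) := by
        rw [Finset.sum_add_distrib, ← Finset.mul_sum, Finset.sum_add_distrib, ← Finset.mul_sum]
        simp only [Finset.sum_const, Finset.card_univ, Fintype.card_fin, nsmul_eq_mul]
        ring
    _ ≤ _ := by
        rw [mul_add]
        gcongr

lemma constQ_nonneg {M τ ξ p : ℝ} (hτ : 0 < τ) (hp : 1 ≤ p) : 0 ≤ constQ M τ ξ p := by
  unfold constQ
  have : 0 ≤ p := by linarith
  positivity

lemma le_constA'_rpow {d : ℕ} {M τ ξ p A₀ A₁ P : ℝ} (hτ : 0 < τ) (hp : 1 ≤ p) (hA₀ : 0 ≤ A₀)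
    (hB : 0 ≤ constB M τ ξ A₁ P) :
    2 ^ (p - 1) * ENNReal.ofReal (A₀ * constQ M τ ξ p) ^ p + 1 ≤
        ENNReal.ofReal (constA' (d + 1) M τ ξ p A₀ A₁ P) ^ p ∧
      d * (2 ^ (p - 1) * ENNReal.ofReal (constB M τ ξ A₁ P * constQ M τ ξ p) ^ p) +
          ENNReal.ofReal ((A₀ + constB M τ ξ A₁ P) * constQ M τ ξ p) ^ p + 1 ≤
        ENNReal.ofReal (constA' (d + 1) M τ ξ p A₀ A₁ P) ^ p := by
  have hp0 : 0 < p := by linarith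
  have hQ := constQ_nonneg (M := M) (ξ := ξ) hτ hp
  have h2 : (2 : ℝ≥0∞) ^ (p - 1) = ENNReal.ofReal ((2 : ℝ) ^ (p - 1)) := by
    rw [← ENNReal.ofReal_rpow_of_pos two_pos, ENNReal.ofReal_ofNat]
  have hd : (d : ℝ≥0∞) = ENNReal.ofReal d := (ENNReal.ofReal_natCast d).symm
  set X := (A₀ * constQ M τ ξ p)
  set Y := (constB M τ ξ A₁ P * constQ M τ ξ p)
  set Z := ((A₀ + constB M τ ξ A₁ P) * constQ M τ ξ p)
  have hX : 0 ≤ X := by positivity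
  have hY : 0 ≤ Y := by positivity
  have hZ : 0 ≤ Z := by positivity
  have hXp : 0 ≤ X ^ p := by positivity
  have hYp : 0 ≤ Y ^ p := by positivity
  have hZp : 0 ≤ Z ^ p := by positivity
  have hA' : constA' (d + 1) M τ ξ p A₀ A₁ P =
      max ((2 : ℝ) ^ (p - 1) * X ^ p + 1)
        ((d * (2 ^ (p - 1) * Y ^ p) + Z ^ p + 1) ^ (1 / p)) := by
    simp [constA', X, Y, Z, mul_assoc]
  have h1le : (1 : ℝ) ≤ (2 : ℝ) ^ (p - 1) * X ^ p + 1 := by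
    have : 0 ≤ (2 : ℝ) ^ (p - 1) * X ^ p := by positivity
    linarith
  have hA0 : 0 ≤ constA' (d + 1) M τ ξ p A₀ A₁ P := by
    rw [hA']; exact le_max_of_le_left (by linarith)
  rw [ENNReal.ofReal_rpow_of_nonneg hX hp0.le, ENNReal.ofReal_rpow_of_nonneg hY hp0.le,
    ENNReal.ofReal_rpow_of_nonneg hZ hp0.le, ENNReal.ofReal_rpow_of_nonneg hA0 hp0.le, h2, hd,
    ← ENNReal.ofReal_one, ← ENNReal.ofReal_mul (by positivity), ← ENNReal.ofReal_mul (by positivity),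
    ← ENNReal.ofReal_mul (by positivity), ← ENNReal.ofReal_add (by positivity) zero_le_one,
    ← ENNReal.ofReal_add (by positivity) (by positivity),
    ← ENNReal.ofReal_add (by positivity) zero_le_one, hA']
  constructor
  · refine ENNReal.ofReal_le_ofReal ?_
    calc _ = ((2 : ℝ) ^ (p - 1) * X ^ p + 1) ^ (1 : ℝ) := (Real.rpow_one _).symm
      _ ≤ ((2 : ℝ) ^ (p - 1) * X ^ p + 1) ^ p := Real.rpow_le_rpow_of_exponent_le h1le hp
      _ ≤ _ := by gcongr; exact le_max_left _ _
  · refine ENNReal.ofReal_le_ofReal ?_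
    calc _ = ((d * (2 ^ (p - 1) * Y ^ p) + Z ^ p + 1) ^ (1 / p)) ^ p := by
          rw [← Real.rpow_mul (by positivity), one_div_mul_cancel hp0.ne', Real.rpow_one]
      _ ≤ _ := by gcongr; exact le_max_right _ _

/-! ### The scale function of Stein's operator -/

/-- The function `g*`, extended by `0` to the closed region above the graph. -/
def gExt {d : ℕ} (φ : Euc d → ℝ) (M τ ξ : ℝ) (δ : Euc (d + 1) → ℝ) : Euc (d + 1) → ℝ :=
  (below φ).indicator (gStar M τ ξ δ)

section
variable {d : ℕ} {φ : Euc d → ℝ} {M τ ξ P : ℝ} {Pm : (Fin (d + 1) → ℕ) → ℝ}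
  {δ : Euc (d + 1) → ℝ}

lemma gExt_apply {x : Euc (d + 1)} (hx : x ∈ below φ) : gExt φ M τ ξ δ x = gStar M τ ξ δ x :=
  indicator_of_mem hx _

lemma isScale_gExt (hφL : ∀ x y, |φ x - φ y| ≤ M * ‖x - y‖) (hτ : 0 < τ)
    (hξ0 : 0 < ξ) (hξ1 : ξ < 1) (hδ : IsRegularizedDistance (below φ)ᶜ ξ Pm δ) :
    IsScale φ τ ((1 + τ) * ((1 + ξ) ^ 2 * √(1 + M ^ 2)) * ((1 - ξ) ^ 2)⁻¹)
      (gExt φ M τ ξ δ) := by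
  have hξ : 0 < 1 - ξ := by linarith
  constructor
  · intro x hx
    rw [gExt_apply hx, gStar, mul_assoc]
    gcongr
    calc _ ≤ √(1 + M ^ 2) * Metric.infDist x (below φ)ᶜ := depth_le_infDist hφL x
      _ = (1 + ξ) ^ 2 * √(1 + M ^ 2) * (((1 + ξ) ^ 2)⁻¹ * Metric.infDist x (below φ)ᶜ) := by
        field_simp
      _ ≤ _ := by
        gcongr
        exact hδ.lower x (by simpa using hx)
  · intro x hx
    rw [gExt_apply hx, gStar, mul_assoc (_ * _) (_⁻¹)]
    gcongr
    refine (hδ.upper x (by simpa using hx)).trans ?_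
    gcongr
    exact infDist_le_depth hx

lemma gExt_eventuallyEq (hφ : Continuous φ) {x : Euc (d + 1)} (hx : x ∈ below φ) :
    gExt φ M τ ξ δ =ᶠ[𝓝 x] gStar M τ ξ δ := by
  filter_upwards [(isOpen_below hφ).mem_nhds hx] with y hy using gExt_apply hy

lemma differentiableAt_of_regularizedDistance (hφ : Continuous φ)
    (hδ : IsRegularizedDistance (below φ)ᶜ ξ Pm δ) {x : Euc (d + 1)} (hx : x ∈ below φ) :
    DifferentiableAt ℝ δ x := by
  have h := hδ.smooth
  rw [compl_compl] at h
  exact (h.contDiffAt ((isOpen_below hφ).mem_nhds hx)).differentiableAt (by simp)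

lemma differentiableAt_gExt (hφ : Continuous φ)
    (hδ : IsRegularizedDistance (below φ)ᶜ ξ Pm δ) {x : Euc (d + 1)} (hx : x ∈ below φ) :
    DifferentiableAt ℝ (gExt φ M τ ξ δ) x :=
  ((differentiableAt_of_regularizedDistance hφ hδ hx).const_mul _).congr_of_eventuallyEq
    (gExt_eventuallyEq hφ hx)

/-- The first-order bounds of the regularized distance do not involve the distance. -/
lemma abs_partialDeriv_gExt_le (hφ : Continuous φ) (hτ : 0 < τ) (hξ0 : 0 < ξ)
    (hδ : IsRegularizedDistance (below φ)ᶜ ξ Pm δ) (hP : ∀ j, Pm (Pi.single j 1) ≤ P)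
    (j : Fin (d + 1)) {x : Euc (d + 1)} (hx : x ∈ below φ) :
    |partialDeriv j (gExt φ M τ ξ δ) x| ≤ (1 + τ) * ((1 + ξ) ^ 2 * √(1 + M ^ 2)) * P := by
  have h1 := hδ.deriv_le (Pi.single j 1) (by simp) x (by simpa using hx)
  rw [multiDeriv_single] at h1
  have hsum : ∑ i, (Pi.single j 1 : Fin (d + 1) → ℕ) i = 1 := by simp
  simp only [hsum, Nat.cast_one, sub_self, zpow_zero, mul_one] at h1
  have h2 : partialDeriv j (gExt φ M τ ξ δ) x =
      (1 + τ) * ((1 + ξ) ^ 2 * √(1 + M ^ 2)) * partialDeriv j δ x := by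
    rw [partialDeriv, (gExt_eventuallyEq hφ hx).fderiv_eq]
    have := ((differentiableAt_of_regularizedDistance hφ hδ hx).hasFDerivAt.const_mul
      ((1 + τ) * ((1 + ξ) ^ 2 * √(1 + M ^ 2)))).fderiv
    have e : gStar M τ ξ δ = fun y => (1 + τ) * ((1 + ξ) ^ 2 * √(1 + M ^ 2)) * δ y := rfl
    rw [e, this]
    simp [partialDeriv]
  have hc : 0 < (1 + τ) * ((1 + ξ) ^ 2 * √(1 + M ^ 2)) := by positivity
  rw [h2, abs_mul, abs_of_pos hc]
  gcongr
  exact h1.trans (hP j)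

lemma exists_mem_below (φ : Euc d → ℝ) : ∃ x, x ∈ below φ :=
  ⟨glue 0 (φ 0 - 1), by simp [below]⟩

lemma exists_lipschitzWith_gExt (hφ : Continuous φ) (hτ : 0 < τ) (hξ0 : 0 < ξ) (hξ1 : ξ < 1)
    (hδ : IsRegularizedDistance (below φ)ᶜ ξ Pm δ) (hP : ∀ j, Pm (Pi.single j 1) ≤ P) :
    ∃ L, LipschitzWith L (gExt φ M τ ξ δ) := by
  have hξ : 0 < 1 - ξ := by linarith
  set c := (1 + τ) * ((1 + ξ) ^ 2 * √(1 + M ^ 2)) with hc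
  have hc0 : 0 < c := by positivity
  have hb := fun j {x} => abs_partialDeriv_gExt_le (M := M) hφ hτ hξ0 hδ hP j (x := x)
  have hcP : 0 ≤ c * P := by
    obtain ⟨x, hx⟩ := exists_mem_below φ
    exact (abs_nonneg _).trans (hb 0 hx)
  refine ⟨_, lipschitzWith_of_infDist (S := (below φ)ᶜ)
    (C₁ := (c * ((1 - ξ) ^ 2)⁻¹).toNNReal) (C₂ := (((d + 1 : ℕ) : ℝ) * (c * P)).toNNReal)
    (fun x hx => indicator_of_notMem hx _) (fun x hx => ?_) (fun x hx => ?_) fun x hx => ?_⟩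
  all_goals rw [notMem_compl_iff] at hx
  · have hδ0 : 0 ≤ δ x :=
      le_trans (by have := Metric.infDist_nonneg (x := x) (s := (below φ)ᶜ); positivity)
        (hδ.lower x (by simpa using hx))
    rw [Real.coe_toNNReal _ (by positivity), gExt_apply hx, gStar, ← hc, abs_mul,
      abs_of_pos hc0, abs_of_nonneg hδ0, mul_assoc c _ (Metric.infDist _ _)]
    gcongr
    exact hδ.upper x (by simpa using hx)
  · exact differentiableAt_gExt hφ hδ hx
  · rw [Real.coe_toNNReal _ (by positivity)]
    exact norm_fderiv_le_of_partialDeriv hcP fun j => hb j hx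

/-- The extension is, up to a null set, the patch of `u` above and of its vertical averages below
the graph. -/
lemma steinExt_ae_eq (hφ : Continuous φ) (ψ : ℝ → ℝ) (u : Euc (d + 1) → ℝ) :
    steinExt (above φ) M τ ξ δ ψ u =ᵐ[volume] patch φ u (vertInt (gExt φ M τ ξ δ) ψ u) := by
  have h : ∀ᵐ x ∂(volume : Measure (Euc (d + 1))), x ∈ above φ ∪ below φ := volume_graph hφ
  filter_upwards [h] with x hx
  rcases hx with hx | hx
  · rw [patch_above hx, steinExt, if_pos (subset_closure hx)]
  · have : x ∉ closure (above φ) := by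
      rw [closure_above hφ]; exact fun h => h hx
    rw [patch_below hx, steinExt, if_neg this, vertInt, gExt_apply hx]

end

lemma IsWeakGrad.congr_left {n : ℕ} {u u' : Euc n → ℝ} {G : Fin n → Euc n → ℝ}
    (h : u =ᵐ[volume] u') (hu : IsWeakGrad Set.univ u G) : IsWeakGrad Set.univ u' G := by
  refine ⟨?_, fun j => ⟨(hu.2 j).1, fun η h1 h2 h3 => ?_⟩⟩
  · have := hu.1
    rw [locallyIntegrableOn_univ] at this ⊢
    exact this.congr h
  · rw [← (hu.2 j).2 η h1 h2 h3]
    refine integral_congr_ae ?_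
    filter_upwards [ae_restrict_of_ae h] with x hx
    rw [hx]

end SteinExtension

end

open SteinExtension in
/-- The dimension is `n = d + 1 ≥ 2`. The bounds hold for `u` in any `W^{1,r}(Ω)`, `1 ≤ r < ∞`;
`r = 2` gives `H¹(Ω)` and `r = p` gives `W^{1,p}(Ω)`. Norms may be infinite when `r ≠ p`. -/
theorem mainTheorem2 {d : ℕ} (hd : 1 ≤ d) (Ω : Set (Euc (d + 1))) (M : ℝ)
    (hΩ : IsSpecialLipschitzDomain M Ω)
    (τ ξ : ℝ) (hτ : 0 < τ) (hξ0 : 0 < ξ) (hξ1 : ξ < 1)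
    (Pm : (Fin (d + 1) → ℕ) → ℝ) (δ : Euc (d + 1) → ℝ)
    (hδ : IsRegularizedDistance (closure Ω) ξ Pm δ)
    (ψ : ℝ → ℝ) (hψ : IsSteinKernel ψ)
    (A₀ A₁ P : ℝ)
    (hA₀ : ∀ t, 1 ≤ t → |ψ t| ≤ A₀ / t ^ 2)
    (hA₁ : ∀ t, 1 ≤ t → |ψ t| ≤ A₁ / t ^ 3)
    (hP : ∀ j, Pm (Pi.single j 1) ≤ P)
    (p : ℝ) (hp : 1 ≤ p) (r : ℝ) (hr : 1 ≤ r)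
    (u : Euc (d + 1) → ℝ) (hu : MemW1 Ω r u) :
    MemW1 Set.univ r (steinExt Ω M τ ξ δ ψ u) ∧
    eLpNorm (steinExt Ω M τ ξ δ ψ u) (ENNReal.ofReal p) volume
      ≤ ENNReal.ofReal (constA M τ ξ p A₀)
        * eLpNorm u (ENNReal.ofReal p) (volume.restrict Ω) ∧
    ∀ G H : Fin (d + 1) → Euc (d + 1) → ℝ,
      IsWeakGrad Ω u G → IsWeakGrad Set.univ (steinExt Ω M τ ξ δ ψ u) H →
      gradLpNorm Set.univ p H
        ≤ ENNReal.ofReal (constA' (d + 1) M τ ξ p A₀ A₁ P) * gradLpNorm Ω p G := by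
  obtain ⟨hM, φ, hφL, rfl⟩ := hΩ
  change IsRegularizedDistance (closure (above φ)) ξ Pm δ at hδ
  change MemW1 (above φ) r u at hu
  change MemW1 Set.univ r (steinExt (above φ) M τ ξ δ ψ u) ∧
    eLpNorm (steinExt (above φ) M τ ξ δ ψ u) (ENNReal.ofReal p) volume
      ≤ ENNReal.ofReal (constA M τ ξ p A₀)
        * eLpNorm u (ENNReal.ofReal p) (volume.restrict (above φ)) ∧
    ∀ G H : Fin (d + 1) → Euc (d + 1) → ℝ,
      IsWeakGrad (above φ) u G → IsWeakGrad Set.univ (steinExt (above φ) M τ ξ δ ψ u) H →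
      gradLpNorm Set.univ p H
        ≤ ENNReal.ofReal (constA' (d + 1) M τ ξ p A₀ A₁ P) * gradLpNorm (above φ) p G
  have hφ := continuous_of_abs_sub_le hφL
  rw [closure_above hφ] at hδ
  have hp0 : 0 < p := by linarith
  have hr1 : 1 ≤ ENNReal.ofReal r := by simpa using ENNReal.ofReal_le_ofReal hr
  set c := (1 + τ) * ((1 + ξ) ^ 2 * √(1 + M ^ 2)) with hc
  set K := c * ((1 - ξ) ^ 2)⁻¹ with hKdef
  have hξ : 0 < 1 - ξ := by linarith
  have hc0 : 0 < c := by positivity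
  have hK : 0 < K := by positivity
  have hQ : K * p / ((p + 1) * τ ^ (1 + 1 / p)) = constQ M τ ξ p := by
    rw [hKdef, hc, constQ]; field_simp
  set g := gExt φ M τ ξ δ with hgdef
  have hs : IsScale φ τ K g := isScale_gExt hφL hτ hξ0 hξ1 hδ
  obtain ⟨Lg, hg⟩ := exists_lipschitzWith_gExt (M := M) hφ hτ hξ0 hξ1 hδ hP
  have hgm : Measurable g := hg.continuous.measurable
  have hg0 : ∀ x ∉ below φ, g x = 0 := fun x hx => Set.indicator_of_notMem hx _
  have hgd : ∀ x ∈ below φ, DifferentiableAt ℝ g x := fun x hx => differentiableAt_gExt hφ hδ hx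
  have hgb : ∀ j, ∀ x ∈ below φ, |partialDeriv j g x| ≤ c * P := fun j x hx =>
    abs_partialDeriv_gExt_le hφ hτ hξ0 hδ hP j hx
  have hcP : 0 ≤ c * P := by
    obtain ⟨x, hx⟩ := exists_mem_below φ
    exact (abs_nonneg _).trans (hgb 0 x hx)
  have hψ0 : IntegrableOn ψ (Set.Ioi 1) := by simpa using hψ.integrable 0
  have hψ1 : IntegrableOn (fun t => t * ψ t) (Set.Ioi 1) := by simpa using hψ.integrable 1
  have hA₁' : ∀ t, 1 ≤ t → |t * ψ t| ≤ A₁ / t ^ 2 := by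
    intro t ht
    have ht0 : 0 < t := by linarith
    rw [abs_mul, abs_of_pos ht0]
    calc t * |ψ t| ≤ t * (A₁ / t ^ 3) := by gcongr; exact hA₁ t ht
      _ = A₁ / t ^ 2 := by field_simp
  have hA₀0 : 0 ≤ A₀ := nonneg_of_kernel_le hA₀
  have hB : c * P * A₁ = constB M τ ξ A₁ P := by rw [hc, constB]; ring
  have hB0 : 0 ≤ constB M τ ξ A₁ P := by
    rw [← hB]; exact mul_nonneg hcP (nonneg_of_kernel_le hA₁')
  obtain ⟨huL, G₀, hG₀, hG₀L⟩ := hu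
  have hext := steinExt_ae_eq (M := M) (τ := τ) (ξ := ξ) (δ := δ) hφ ψ u
  rw [← hgdef] at hext
  set E := steinExt (above φ) M τ ξ δ ψ u with hE
  have hvL := hs.memLp_vertInt hφ hτ hK hgm hA₀ hψ0.aestronglyMeasurable hr huL
  have hdL := hs.memLp_extGrad hφ hτ hK hgm hgb hψ0 hψ1 hA₀ hA₁' hr hG₀L
  have hEL : MemLp (patch φ u (vertInt g ψ u)) (ENNReal.ofReal r) volume := memLp_patch hφ huL hvL
  have hWL : ∀ j, MemLp (patch φ (G₀ j) (extGrad g ψ G₀ j)) (ENNReal.ofReal r) volume :=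
    fun j => memLp_patch hφ (hG₀L j) (hdL j)
  have hW : IsWeakGrad Set.univ E fun j => patch φ (G₀ j) (extGrad g ψ G₀ j) := by
    refine IsWeakGrad.congr_left hext.symm
      ⟨(hEL.locallyIntegrable hr1).locallyIntegrableOn _, fun j =>
        ⟨((hWL j).locallyIntegrable hr1).locallyIntegrableOn _, fun η hη hηs _ => ?_⟩⟩
    have hηc : Continuous (partialDeriv j η) :=
      (hη.continuous_fderiv (by simp)).clm_apply continuous_const
    have hηcs : HasCompactSupport (partialDeriv j η) := hηs.fderiv_apply ℝ _
    rw [Measure.restrict_univ,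
      integral_patch_mul hφ (integrable_mul_of_memLp hr hηc hηcs hEL),
      integral_patch_mul hφ (integrable_mul_of_memLp hr hη.continuous hηs (hWL j))]
    exact hs.integral_patch_mul_partialDeriv hM hφL hφ hτ hK hg hg0 hgd hgb hψ0 hψ1
      hψ.integral_one hA₀ hA₁' hr huL hG₀L hG₀ hη hηs j
  refine ⟨?_, ?_, ?_⟩
  · refine ⟨?_, _, hW, fun j => ?_⟩
    · rw [Measure.restrict_univ]
      exact hEL.ae_eq hext.symm
    · rw [Measure.restrict_univ]
      exact hWL j
  · have hX : 0 ≤ A₀ * constQ M τ ξ p := mul_nonneg hA₀0 (constQ_nonneg hτ hp)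
    have hXp : 0 ≤ (A₀ * constQ M τ ξ p) ^ p := Real.rpow_nonneg hX _
    rw [eLpNorm_congr_ae hext, ← ENNReal.rpow_le_rpow_iff hp0,
      ENNReal.mul_rpow_of_nonneg _ _ hp0.le, eLpNorm_ofReal_rpow _ _ hp,
      eLpNorm_ofReal_rpow _ _ hp, lintegral_patch hφ]
    have hA : ENNReal.ofReal (constA M τ ξ p A₀) ^ p =
        ENNReal.ofReal (A₀ * constQ M τ ξ p) ^ p + 1 := by
      rw [ENNReal.ofReal_rpow_of_nonneg hX hp0.le, ← ENNReal.ofReal_one,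
        ← ENNReal.ofReal_add hXp zero_le_one, constA,
        ENNReal.ofReal_rpow_of_nonneg (by positivity) hp0.le, ← Real.rpow_mul (by positivity),
        one_div_mul_cancel hp0.ne', Real.rpow_one]
    rw [hA, add_mul, one_mul, add_comm]
    gcongr
    have := lintegral_vertInt_le hs hφ hτ hK hgm hA₀ hp huL.1
    rwa [hQ] at this
  · intro G H hG hH
    -- both gradients agree almost everywhere with the ones constructed above
    rw [gradLpNorm_congr p fun j => hH.ae_eq isOpen_univ hW j,
      gradLpNorm_congr p fun j => hG.ae_eq (isOpen_above hφ) hG₀ j]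
    obtain ⟨h1, h2⟩ := le_constA'_rpow (d := d) (M := M) (ξ := ξ) hτ hp hA₀0 hB0
    have hlast := hs.lintegral_extGrad_last_le hφ hτ hK hgm hcP hgb hA₀ hA₁' hp
      fun j => (hG₀L j).1
    have hall := hs.lintegral_extGrad_le hφ hτ hK hgm hcP hgb hψ0.aestronglyMeasurable hA₀ hA₁' hp
      fun j => (hG₀L j).1
    rw [hB, hQ] at hlast
    simp only [hB, hQ] at hall
    have key := sum_gradient_bound (fun j => ∫⁻ x in above φ, ‖G₀ j x‖ₑ ^ p)
      (fun j => ∫⁻ x in below φ, ‖extGrad g ψ G₀ j x‖ₑ ^ p) hlast hall h1 h2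
    unfold gradLpNorm
    rw [Measure.restrict_univ]
    simp only [lintegral_patch hφ]
    calc _ ≤ (ENNReal.ofReal (constA' (d + 1) M τ ξ p A₀ A₁ P) ^ p *
          ∑ j, ∫⁻ x in above φ, ‖G₀ j x‖ₑ ^ p) ^ (1 / p) := by gcongr
      _ = _ := by
        rw [ENNReal.mul_rpow_of_nonneg _ _ (by positivity), ← ENNReal.rpow_mul,
          mul_one_div_cancel hp0.ne', ENNReal.rpow_one]
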